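/- By a unit-area pentagon we mean a simple (not necessarily convex) pentagon in the Euclidean plane that encloses area $1$. A unit-area pentagon is called efficient if its perimeter is at most $2\sqrt{2+\sqrt3}\approx 3.8637$, the perimeter of the unit-area Cairo pentagon. (1) Let $e>0$. Among all unit-area pentagons that have an edge of length $e$ there is one of least perimeter. A unit-area pentagon with a given edge $E$ of length $e$ is such a perimeter minimizer if and only if it is inscribed in a circle and its four edges other than $E$ have equal lengths. The minimizer is unique up to congruence: if $P$ and $Q$ are minimizers with vertices listed consecutively as $P_0,\dots,P_4$ and $Q_0,\dots,Q_4$, so that $|P_0P_1|=|Q_0Q_1|=e$, then $|P_aP_b|=|Q_aQ_b|$ for all $a,b$. (2) Every edge of an efficient pentagon has length strictly between $0.3928$ and $1.092$. Every edge of a unit-area pentagon with perimeter at most $3.86$ has length strictly between $0.4073$ and $1.081$. -/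

import Mathlib

open MeasureTheory

noncomputable section

/-- The Euclidean plane. -/
abbrev Plane : Type := EuclideanSpace ℝ (Fin 2)

namespace Polygon

variable {n : ℕ}

/-- The length of the `i`-th edge, which joins vertex `i` to the cyclically next vertex. -/
def edgeLength (p : Polygon Plane n) (i : Fin n) : ℝ :=
  dist (p i) (p (finRotate n i))

/-- The perimeter: the sum of all edge lengths. -/
def perimeter (p : Polygon Plane n) : ℝ :=
  ∑ i, p.edgeLength i

/-- A closed polygon (with at least three vertices) is simple if its vertices are distinct and two
different edges meet at most in a common endpoint. Convexity is not required. -/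
def IsSimple (p : Polygon Plane n) : Prop :=
  Function.Injective p.vertices ∧
    ∀ i j : Fin n, i ≠ j →
      p.edgeSet ℝ i ∩ p.edgeSet ℝ j ⊆
        ({p i, p (finRotate n i)} ∩ {p j, p (finRotate n j)} : Set Plane)

/-- The region enclosed by the polygon: the union of the bounded connected components of the
complement of its boundary. -/
def enclosedRegion (p : Polygon Plane n) : Set Plane :=
  {x | x ∉ p.boundary ℝ ∧
    Bornology.IsBounded (connectedComponentIn (p.boundary ℝ)ᶜ x)}

/-- The area: the two-dimensional Lebesgue measure of the enclosed region. -/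
def area (p : Polygon Plane n) : ENNReal :=
  volume p.enclosedRegion

end Polygon

/-- A unit-area pentagon: a simple, not necessarily convex, pentagon of area one. -/
def IsUnitPentagon (p : Polygon Plane 5) : Prop :=
  p.IsSimple ∧ p.area = 1

/-- `p` has least perimeter among the unit-area pentagons that have an edge of length `e`. -/
def IsPerimeterMinimizer (e : ℝ) (p : Polygon Plane 5) : Prop :=
  (IsUnitPentagon p ∧ ∃ i, p.edgeLength i = e) ∧
    ∀ q : Polygon Plane 5, IsUnitPentagon q → (∃ j, q.edgeLength j = e) →
      p.perimeter ≤ q.perimeter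

/-- An efficient pentagon: a unit-area pentagon whose perimeter is at most `2√(2 + √3)`, the
perimeter of a unit-area Cairo pentagon. -/
def IsEfficientPentagon (p : Polygon Plane 5) : Prop :=
  IsUnitPentagon p ∧ p.perimeter ≤ 2 * √(2 + √3)

end

/-!
**Area.** Counting the crossings of the upward vertical ray from a point with the edges of a simple
polygon gives a locally constant winding number on the complement of the boundary, which jumps by
one across every edge. Near each of its points the boundary has only two sides, so the complement
has exactly two components and the winding number is `0` on one and `±1` on the other. Integrating
it edge by edge, as areas under graphs, shows that the area is the absolute value of the shoelace
sum.

**Inequality.** Let `A` be the signed area enclosed by a path of `n` edges with chord `e`. For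
`0 < θ` and `nθ < π` the difference between the two sides of
`4 A + cot (nθ) e ^ 2 ≤ cot θ * ∑ |edge| ^ 2`
is a sum of squares, all of which vanish only if the path is a regular arc with angle `2θ` at the
center for each edge. Moving vertices parallel to the chord of their neighbours keeps the area and
replaces the path by an equilateral one that is no longer, so `∑ |edge| ^ 2` can be replaced by
`length ^ 2 / n`. Given `e`, take `θ` such that the regular arc with four edges and chord `e` has
area one: the arc is then the only minimizer. Conversely, equal edges inscribed in a circle wind
steadily in one direction unless they backtrack, and they do not cross only if each subtends less
than a right angle at the center, so simplicity forces a regular arc.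

**Bounds.** For `θ = arctan t` the inequality becomes a rational quadratic inequality in the edge
length, convex as a constraint, so a few values of `t` checked at the ends of intervals exclude all
lengths outside the stated range.
-/

noncomputable section

open Filter Topology

/-! ### Components of the complement of a two-sided set -/

section TwoSided

variable {X : Type*}

/-- A set is two-sided at `z` if it cuts every small ball about `z` into two connected sides, each
of which accumulates at every point of the set in that ball. -/
def IsTwoSided [PseudoMetricSpace X] (Γ : Set X) (z : X) : Prop :=
  ∀ᶠ r in 𝓝[>] (0 : ℝ), ∃ A B : Set X, IsPreconnected A ∧ IsPreconnected B ∧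
    A ∪ B = Metric.ball z r \ Γ ∧ Metric.ball z r ∩ Γ ⊆ closure A ∩ closure B

/-- The connected components of the complement of `Γ` that accumulate at `z`. -/
def adjacentComponents [TopologicalSpace X] (Γ : Set X) (z : X) : Set (Set X) :=
  {C | ∃ x ∉ Γ, connectedComponentIn Γᶜ x = C ∧ z ∈ closure C}

lemma eventually_nhdsGT_forall_mem_ball [PseudoMetricSpace X] {P : X → Prop} {z : X}
    (h : ∀ᶠ y in 𝓝 z, P y) : ∀ᶠ r in 𝓝[>] (0 : ℝ), ∀ y ∈ Metric.ball z r, P y := by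
  obtain ⟨r, hr, h⟩ := Metric.eventually_nhds_iff_ball.1 h
  filter_upwards [Ioo_mem_nhdsGT hr] with r' hr' y hy
  exact h y (Metric.ball_subset_ball hr'.2.le hy)

lemma IsTwoSided.congr [PseudoMetricSpace X] {Γ Γ' : Set X} {z : X} (h : IsTwoSided Γ z)
    (hΓ : ∀ᶠ y in 𝓝 z, y ∈ Γ ↔ y ∈ Γ') : IsTwoSided Γ' z := by
  filter_upwards [h, eventually_nhdsGT_forall_mem_ball hΓ] with r ⟨A, B, hA, hB, hAB, hcl⟩ hr
  refine ⟨A, B, hA, hB, ?_, fun y hy => hcl ⟨hy.1, (hr y hy.1).2 hy.2⟩⟩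
  rw [hAB]
  ext y
  exact and_congr_right fun hy => not_congr (hr y hy)

lemma IsTwoSided.eventually_adjacentComponents_eq [PseudoMetricSpace X] {Γ : Set X} {z : X}
    (h : IsTwoSided Γ z) (hz : z ∈ Γ) :
    ∃ a ∉ Γ, ∃ b ∉ Γ, ∀ᶠ w in 𝓝 z, w ∈ Γ →
      adjacentComponents Γ w = {connectedComponentIn Γᶜ a, connectedComponentIn Γᶜ b} := by
  obtain ⟨r, ⟨A, B, hA, hB, hAB, hcl⟩, hr : 0 < r⟩ := (h.and eventually_mem_nhdsWithin).exists
  have hAΓ : A ⊆ Γᶜ := fun y hy => (hAB.subset (Or.inl hy)).2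
  have hBΓ : B ⊆ Γᶜ := fun y hy => (hAB.subset (Or.inr hy)).2
  have hz' := hcl ⟨Metric.mem_ball_self hr, hz⟩
  obtain ⟨a, ha⟩ := closure_nonempty_iff.1 ⟨z, hz'.1⟩
  obtain ⟨b, hb⟩ := closure_nonempty_iff.1 ⟨z, hz'.2⟩
  have hAa := hA.subset_connectedComponentIn ha hAΓ
  have hBb := hB.subset_connectedComponentIn hb hBΓ
  refine ⟨a, hAΓ ha, b, hBΓ hb, ?_⟩
  filter_upwards [Metric.ball_mem_nhds z hr] with w hw hwΓ
  ext C
  constructor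
  · rintro ⟨x, -, rfl, hwx⟩
    obtain ⟨y, hy, hyx⟩ := mem_closure_iff.1 hwx _ Metric.isOpen_ball hw
    rw [connectedComponentIn_eq hyx]
    rcases hAB.superset ⟨hy, connectedComponentIn_subset _ _ hyx⟩ with hyA | hyB
    · exact Or.inl (connectedComponentIn_eq (hAa hyA)).symm
    · exact Or.inr (connectedComponentIn_eq (hBb hyB)).symm
  · rintro (rfl | rfl)
    · exact ⟨a, hAΓ ha, rfl, closure_mono hAa (hcl ⟨hw, hwΓ⟩).1⟩
    · exact ⟨b, hBΓ hb, rfl, closure_mono hBb (hcl ⟨hw, hwΓ⟩).2⟩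

lemma exists_mem_closure_connectedComponentIn_compl [TopologicalSpace X] [PreconnectedSpace X]
    [LocallyConnectedSpace X] {Γ : Set X} (hΓ : IsClosed Γ) (hne : Γ.Nonempty) {x : X}
    (hx : x ∉ Γ) : ∃ z ∈ Γ, z ∈ closure (connectedComponentIn Γᶜ x) := by
  have hopen : ∀ y, IsOpen (connectedComponentIn Γᶜ y) := fun _ =>
    hΓ.isOpen_compl.connectedComponentIn
  obtain ⟨w, hw⟩ := hne
  obtain ⟨z, hz⟩ : (frontier (connectedComponentIn Γᶜ x)).Nonempty :=
    nonempty_frontier_iff.2 ⟨⟨x, mem_connectedComponentIn hx⟩, fun h =>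
      connectedComponentIn_subset Γᶜ x (h ▸ Set.mem_univ w) hw⟩
  refine ⟨z, ?_, hz.1⟩
  by_contra hzΓ
  obtain ⟨y, hyz, hyx⟩ :=
    mem_closure_iff.1 hz.1 _ (hopen z) (mem_connectedComponentIn (F := Γᶜ) hzΓ)
  have hzx : connectedComponentIn Γᶜ z = connectedComponentIn Γᶜ x :=
    (connectedComponentIn_eq hyz).trans (connectedComponentIn_eq hyx).symm
  exact hz.2 ((hopen x).interior_eq.symm ▸ hzx ▸ mem_connectedComponentIn (F := Γᶜ) hzΓ)

-- The set of components accumulating at a point of `Γ` is locally constant along `Γ`.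
theorem IsTwoSided.connectedComponentIn_eq_or_eq [PseudoMetricSpace X] [PreconnectedSpace X]
    [LocallyConnectedSpace X] {Γ : Set X} (hclosed : IsClosed Γ) (hconn : IsConnected Γ)
    (h : ∀ z ∈ Γ, IsTwoSided Γ z) :
    ∃ a ∉ Γ, ∃ b ∉ Γ, ∀ x ∉ Γ, connectedComponentIn Γᶜ x = connectedComponentIn Γᶜ a ∨
      connectedComponentIn Γᶜ x = connectedComponentIn Γᶜ b := by
  obtain ⟨z₀, hz₀⟩ := hconn.nonempty
  have hloc : IsLocallyConstant fun z : Γ => adjacentComponents Γ (z : X) := by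
    refine (IsLocallyConstant.iff_eventually_eq _).2 fun z => ?_
    obtain ⟨a, -, b, -, hab⟩ := (h z z.2).eventually_adjacentComponents_eq z.2
    filter_upwards [continuous_subtype_val.continuousAt.eventually hab] with w hw
    rw [hw w.2, hab.self_of_nhds z.2]
  have : PreconnectedSpace Γ := isPreconnected_iff_preconnectedSpace.1 hconn.isPreconnected
  obtain ⟨a, ha, b, hb, hab⟩ := (h z₀ hz₀).eventually_adjacentComponents_eq hz₀
  refine ⟨a, ha, b, hb, fun x hx => ?_⟩
  obtain ⟨z, hz, hzx⟩ :=
    exists_mem_closure_connectedComponentIn_compl hclosed hconn.nonempty hx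
  have hmem : connectedComponentIn Γᶜ x ∈ adjacentComponents Γ z := ⟨x, hx, rfl, hzx⟩
  rwa [hloc.apply_eq_of_preconnectedSpace ⟨z, hz⟩ ⟨z₀, hz₀⟩, hab.self_of_nhds hz₀] at hmem

end TwoSided

namespace Plane

/-! ### The winding number -/

section Crossing

/-- Twice the signed area of the triangle `a b x`; positive when `x` lies to the left of `ab`. -/
def cross (a b x : Plane) : ℝ :=
  (b 0 - a 0) * (x 1 - a 1) - (b 1 - a 1) * (x 0 - a 0)

/-- The points strictly below the segment `ab`, when `a` is to the left of `b`; empty otherwise.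
The left end is included and the right end is not, so that the sets of consecutive segments do
not overlap. -/
def below (a b : Plane) : Set Plane :=
  {x | a 0 ≤ x 0 ∧ x 0 < b 0 ∧ cross a b x < 0}

open Classical in
/-- The signed number of crossings of the upward vertical ray from `x` with the segment `ab`. -/
def crossing (a b x : Plane) : ℤ :=
  (if x ∈ below b a then 1 else 0) - (if x ∈ below a b then 1 else 0)

/-- The change at `y` near `x` of the crossing number of a segment ending at `a` that is due to
the vertical ray from `x` passing through `a`. -/
def vertexTerm (a x y : Plane) : ℤ :=
  if a 0 = x 0 ∧ x 1 < a 1 ∧ a 0 ≤ y 0 then 1 else 0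

/-- The crossing number of `ab` at `y`, corrected so as not to jump at `y = x` when the vertical
ray from `x` passes through `a` or `b`. Around a closed polygon the corrections cancel. -/
def correctedCrossing (a b x y : Plane) : ℤ :=
  crossing a b y + vertexTerm a x y - vertexTerm b x y

variable {a b x y z : Plane}

lemma cross_swap (a b x : Plane) : cross b a x = -cross a b x := by
  simp only [cross]; ring

lemma cross_left (a b : Plane) : cross a b a = 0 := by simp [cross]

lemma cross_right (a b : Plane) : cross a b b = 0 := by simp [cross, mul_comm]

lemma cross_rotate (a b c : Plane) : cross b c a = cross a b c := by
  simp only [cross]; ring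

@[fun_prop]
lemma continuous_cross (a b : Plane) : Continuous (cross a b) := by
  unfold cross; fun_prop

lemma lineMap_coord (x y : Plane) (t : ℝ) (i : Fin 2) :
    (AffineMap.lineMap x y t : Plane) i = x i + t * (y i - x i) := by
  simp [AffineMap.lineMap_apply, add_comm]

lemma cross_lineMap (a b x y : Plane) (t : ℝ) :
    cross a b (AffineMap.lineMap x y t) = (1 - t) * cross a b x + t * cross a b y := by
  simp only [cross, lineMap_coord]; ring

lemma cross_eq_zero_of_mem (h : y ∈ affineSegment ℝ a b) : cross a b y = 0 := by
  obtain ⟨t, -, rfl⟩ := h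
  rw [cross_lineMap, cross_left, cross_right, mul_zero, mul_zero, add_zero]

lemma lineMap_inner_div_of_cross_eq_zero (hab : a ≠ b) (h : cross a b y = 0) :
    AffineMap.lineMap a b (inner ℝ (b - a) (y - a) / ‖b - a‖ ^ 2) = y := by
  have hn : (b 0 - a 0) ^ 2 + (b 1 - a 1) ^ 2 ≠ 0 := by
    have : ‖b - a‖ ^ 2 ≠ 0 := pow_ne_zero 2 (norm_ne_zero_iff.2 (sub_ne_zero.2 hab.symm))
    simpa [EuclideanSpace.norm_sq_eq] using this
  have hi : inner ℝ (b - a) (y - a) / ‖b - a‖ ^ 2 =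
      ((b 0 - a 0) * (y 0 - a 0) + (b 1 - a 1) * (y 1 - a 1)) /
        ((b 0 - a 0) ^ 2 + (b 1 - a 1) ^ 2) := by
    simp [EuclideanSpace.norm_sq_eq, PiLp.inner_apply, mul_comm]
  simp only [cross] at h
  ext i
  rw [lineMap_coord, hi, div_mul_eq_mul_div, ← eq_sub_iff_add_eq', div_eq_iff hn]
  fin_cases i <;> simp only [Fin.zero_eta, Fin.mk_one, Fin.isValue]
  · linear_combination (b 1 - a 1) * h
  · linear_combination -(b 0 - a 0) * h

lemma crossing_swap (a b x : Plane) : crossing b a x = -crossing a b x := by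
  simp [crossing]

lemma correctedCrossing_swap (a b x y : Plane) :
    correctedCrossing b a x y = -correctedCrossing a b x y := by
  simp only [correctedCrossing, crossing_swap a b]; ring

lemma eventually_correctedCrossing_eq_of_lt (hab : a 0 < b 0) (hx : x ∉ affineSegment ℝ a b) :
    ∃ k, ∀ᶠ y in 𝓝 x, correctedCrossing a b x y = k := by
  have hcoord : ContinuousAt (fun y : Plane => y 0) x := by fun_prop
  have hcross := (continuous_cross a b).continuousAt (x := x)
  have hleft : x 0 = a 0 → cross a b x = (b 0 - a 0) * (x 1 - a 1) := fun h => by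
    rw [cross, h]; ring
  have hright : x 0 = b 0 → cross a b x = (b 0 - a 0) * (x 1 - b 1) := fun h => by
    rw [cross, h]; ring
  simp only [correctedCrossing, crossing, below, vertexTerm, Set.mem_ofPred_eq]
  rcases lt_or_ge (x 0) (a 0) with hxa | hxa
  · refine ⟨0, ?_⟩
    filter_upwards [hcoord.eventually_lt_const hxa] with y hy
    grind
  rcases lt_or_ge (b 0) (x 0) with hxb | hxb
  · refine ⟨0, ?_⟩
    filter_upwards [hcoord.eventually_const_lt hxb] with y hy
    grind
  rcases lt_trichotomy (cross a b x) 0 with hc | hc | hc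
  · have hxa' : x 0 = a 0 → x 1 < a 1 := fun h => by nlinarith [hleft h]
    have hxb' : x 0 = b 0 → x 1 < b 1 := fun h => by nlinarith [hright h]
    refine ⟨if x 0 = a 0 then 0 else -1, ?_⟩
    filter_upwards [hcross.eventually_lt_const hc,
      eventually_imp_distrib_left.2 fun h : a 0 < x 0 => hcoord.eventually_const_lt h,
      eventually_imp_distrib_left.2 fun h : x 0 < b 0 => hcoord.eventually_lt_const h]
      with y hy hya hyb
    grind
  · refine absurd ?_ hx
    rw [← lineMap_inner_div_of_cross_eq_zero (by rintro rfl; exact lt_irrefl _ hab) hc] at hxa hxb ⊢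
    rw [lineMap_coord] at hxa hxb
    exact ⟨_, ⟨by nlinarith, by nlinarith⟩, rfl⟩
  · have hxa' : x 0 = a 0 → a 1 < x 1 := fun h => by nlinarith [hleft h]
    have hxb' : x 0 = b 0 → b 1 < x 1 := fun h => by nlinarith [hright h]
    refine ⟨0, ?_⟩
    filter_upwards [hcross.eventually_const_lt hc] with y hy
    grind

lemma correctedCrossing_eq_zero_of_eq (hab : a 0 = b 0) (hx : x ∉ affineSegment ℝ a b)
    (y : Plane) : correctedCrossing a b x y = 0 := by
  have hlt : x 0 = a 0 → (x 1 < a 1 ↔ x 1 < b 1) := by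
    intro hxa
    by_contra hne
    have hab' : a ≠ b := by rintro rfl; exact hne Iff.rfl
    have hc : cross a b x = 0 := by rw [cross, hab, hxa, hab]; ring
    refine hx ?_
    rw [← lineMap_inner_div_of_cross_eq_zero hab' hc, lineMap_coord] at hne
    rw [← lineMap_inner_div_of_cross_eq_zero hab' hc]
    refine ⟨_, ?_, rfl⟩
    generalize inner ℝ (b - a) (x - a) / ‖b - a‖ ^ 2 = t at hne
    by_cases h : a 1 + t * (b 1 - a 1) < a 1
    · have hb := not_lt.1 fun hb => hne (iff_of_true h hb)
      constructor <;> nlinarith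
    · have hb := not_le.1 fun hb => hne (iff_of_false h (not_lt.2 hb))
      constructor <;> nlinarith
  simp only [correctedCrossing, crossing, below, vertexTerm, Set.mem_ofPred_eq]
  grind

lemma eventually_correctedCrossing_eq (hx : x ∉ affineSegment ℝ a b) :
    ∃ k, ∀ᶠ y in 𝓝 x, correctedCrossing a b x y = k := by
  rcases lt_trichotomy (a 0) (b 0) with h | h | h
  · exact eventually_correctedCrossing_eq_of_lt h hx
  · exact ⟨0, Eventually.of_forall (correctedCrossing_eq_zero_of_eq h hx)⟩
  · rw [affineSegment_comm] at hx
    obtain ⟨k, hk⟩ := eventually_correctedCrossing_eq_of_lt h hx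
    exact ⟨-k, hk.mono fun y hy => by rw [correctedCrossing_swap b a, hy]⟩

lemma eventually_correctedCrossing_eq_of_sbtw_of_lt (hz : Sbtw ℝ a z b)
    (hab : a 0 < b 0 ∨ a 0 = b 0 ∧ a 1 < b 1) :
    ∀ᶠ y in 𝓝 z, cross a b y ≠ 0 →
      correctedCrossing a b z y = -1 + if 0 < cross a b y then 1 else 0 := by
  have hcoord : ContinuousAt (fun y : Plane => y 0) z := by fun_prop
  obtain ⟨⟨t, ⟨ht₀, ht₁⟩, ht⟩, -⟩ := sbtw_iff_mem_image_Ioo_and_ne.1 hz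
  have hzi (i : Fin 2) : z i = a i + t * (b i - a i) := by rw [← ht, lineMap_coord]
  simp only [correctedCrossing, crossing, below, vertexTerm, Set.mem_ofPred_eq]
  rcases hab with h | ⟨h, h'⟩
  · have hza : a 0 < z 0 := by rw [hzi]; nlinarith
    have hzb : z 0 < b 0 := by rw [hzi]; nlinarith
    filter_upwards [hcoord.eventually_const_lt hza, hcoord.eventually_lt_const hzb] with y _ _ _
    grind
  · refine Eventually.of_forall fun y _ => ?_
    have hz₀ : z 0 = a 0 := by rw [hzi, h]; ring
    have hza : a 1 < z 1 := by rw [hzi]; nlinarith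
    have hzb : z 1 < b 1 := by rw [hzi]; nlinarith
    have hcy : cross a b y = (b 1 - a 1) * (a 0 - y 0) := by rw [cross, h]; ring
    have hy : 0 < cross a b y ↔ y 0 < a 0 := by
      rw [hcy, mul_pos_iff_of_pos_left (sub_pos.2 h'), sub_pos]
    simp only [hy]
    grind

lemma eventually_correctedCrossing_eq_of_sbtw (hz : Sbtw ℝ a z b) :
    ∃ k, ∀ᶠ y in 𝓝 z, cross a b y ≠ 0 →
      correctedCrossing a b z y = k + if 0 < cross a b y then 1 else 0 := by
  by_cases hab : a 0 < b 0 ∨ a 0 = b 0 ∧ a 1 < b 1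
  · exact ⟨-1, eventually_correctedCrossing_eq_of_sbtw_of_lt hz hab⟩
  have hne : a 1 = b 1 → a 0 ≠ b 0 := fun h₁ h₀ => hz.left_ne_right (by
    ext i; fin_cases i <;> assumption)
  refine ⟨0, ?_⟩
  filter_upwards [eventually_correctedCrossing_eq_of_sbtw_of_lt hz.symm (by grind)] with y hy hc
  rw [cross_swap a b] at hy
  rw [correctedCrossing_swap b a, hy (neg_ne_zero.2 hc)]
  grind

end Crossing

end Plane

lemma affineSegment_union_of_wbtw {E : Type*} [AddCommGroup E] [Module ℝ E] {a z b : E}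
    (h : Wbtw ℝ a z b) : affineSegment ℝ a z ∪ affineSegment ℝ z b = affineSegment ℝ a b := by
  obtain ⟨t, ⟨ht₀, ht₁⟩, rfl⟩ := h
  have himage {r s : ℝ} (hrs : r ≤ s) :
      affineSegment ℝ (AffineMap.lineMap a b r) (AffineMap.lineMap a b s) =
        AffineMap.lineMap a b '' Set.Icc r s := by
    rw [← segment_eq_Icc hrs, ← affineSegment_eq_segment, affineSegment_image]
  have hleft := himage ht₀
  have hright := himage ht₁
  rw [AffineMap.lineMap_apply_zero] at hleft
  rw [AffineMap.lineMap_apply_one] at hright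
  rw [hleft, hright, ← Set.image_union, Set.Icc_union_Icc_eq_Icc ht₀ ht₁, affineSegment]

lemma mem_closure_of_forall_add_smul_mem {E : Type*} [TopologicalSpace E] [AddCommGroup E]
    [Module ℝ E] [ContinuousAdd E] [ContinuousSMul ℝ E] {s : Set E} {z : E} (v : E)
    (h : ∀ δ : ℝ, 0 < δ → z + δ • v ∈ s) : z ∈ closure s := by
  have hlim : Tendsto (fun δ : ℝ => z + δ • v) (𝓝[>] 0) (𝓝 z) :=
    (Continuous.tendsto' (by fun_prop) 0 z (by simp)).mono_left nhdsWithin_le_nhds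
  exact mem_closure_of_tendsto hlim (eventually_mem_nhdsWithin.mono h)

namespace Plane

section Boundary

variable {a b z : Plane}

lemma convex_cross_pos (a b : Plane) : Convex ℝ {y | 0 < cross a b y} := by
  intro x hx y hy s t hs ht hst
  have hcomb : cross a b (s • x + t • y) = s * cross a b x + t * cross a b y := by
    obtain rfl : s = 1 - t := by linarith
    simp only [cross, PiLp.add_apply, PiLp.smul_apply, smul_eq_mul]; ring
  rw [Set.mem_ofPred_eq, hcomb]
  exact convex_Ioi (0 : ℝ) hx hy hs ht hst

lemma convex_cross_neg (a b : Plane) : Convex ℝ {y | cross a b y < 0} := by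
  simpa only [cross_swap a b, neg_pos] using convex_cross_pos b a

lemma mem_closure_cross_pos (hab : a ≠ b) (hz : cross a b z = 0) :
    z ∈ closure {y | 0 < cross a b y} := by
  refine mem_closure_of_forall_add_smul_mem !₂[-(b 1 - a 1), b 0 - a 0] fun δ hδ => ?_
  have hadd : cross a b (z + δ • !₂[-(b 1 - a 1), b 0 - a 0]) = δ * ‖b - a‖ ^ 2 := by
    rw [← add_zero (δ * _), ← hz]
    simp only [cross, EuclideanSpace.norm_sq_eq, Fin.sum_univ_two, Real.norm_eq_abs, sq_abs,
      PiLp.add_apply, PiLp.sub_apply, PiLp.smul_apply, smul_eq_mul, Matrix.cons_val_zero,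
      Matrix.cons_val_one]
    ring
  have := norm_pos_iff.2 (sub_ne_zero.2 hab.symm)
  rw [Set.mem_ofPred_eq, hadd]
  positivity

lemma mem_closure_cross_neg (hab : a ≠ b) (hz : cross a b z = 0) :
    z ∈ closure {y | cross a b y < 0} := by
  have := mem_closure_cross_pos hab.symm (z := z) (by rw [cross_swap, hz, neg_zero])
  simpa only [cross_swap a b, neg_pos] using this

lemma eventually_mem_affineSegment_iff_of_sbtw (hz : Sbtw ℝ a z b) :
    ∀ᶠ y in 𝓝 z, y ∈ affineSegment ℝ a b ↔ cross a b y = 0 := by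
  have hab := hz.left_ne_right
  obtain ⟨⟨t, ⟨ht₀, ht₁⟩, rfl⟩, -⟩ := sbtw_iff_mem_image_Ioo_and_ne.1 hz
  have hparam : ContinuousAt (fun y => inner ℝ (b - a) (y - a) / ‖b - a‖ ^ 2)
      (AffineMap.lineMap a b t) := by fun_prop
  have hparam_eq : inner ℝ (b - a) (AffineMap.lineMap a b t - a) / ‖b - a‖ ^ 2 = t := by
    rw [AffineMap.lineMap_apply, vsub_eq_sub, vadd_eq_add, add_sub_cancel_right,
      real_inner_smul_right, real_inner_self_eq_norm_sq, mul_div_cancel_right₀]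
    exact pow_ne_zero 2 (norm_ne_zero_iff.2 (sub_ne_zero.2 hab.symm))
  filter_upwards [hparam.eventually_const_lt (hparam_eq ▸ ht₀),
    hparam.eventually_lt_const (hparam_eq ▸ ht₁)] with y h₀ h₁
  exact ⟨cross_eq_zero_of_mem,
    fun hy => ⟨_, ⟨h₀.le, h₁.le⟩, lineMap_inner_div_of_cross_eq_zero hab hy⟩⟩

lemma isTwoSided_affineSegment (hz : Sbtw ℝ a z b) : IsTwoSided (affineSegment ℝ a b) z := by
  filter_upwards [eventually_nhdsGT_forall_mem_ball
    (eventually_mem_affineSegment_iff_of_sbtw hz)] with r hr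
  refine ⟨Metric.ball z r ∩ {y | 0 < cross a b y}, Metric.ball z r ∩ {y | cross a b y < 0},
    ((convex_ball z r).inter (convex_cross_pos a b)).isPreconnected,
    ((convex_ball z r).inter (convex_cross_neg a b)).isPreconnected, ?_, fun y hy => ?_⟩
  · rw [← Set.inter_union_distrib_left]
    ext y
    refine and_congr_right fun hy => ?_
    rw [hr y hy, ← ne_eq, ne_iff_gt_or_lt]
    rfl
  · have hy₀ : cross a b y = 0 := (hr y hy.1).1 hy.2
    exact ⟨Metric.isOpen_ball.inter_closure
        ⟨hy.1, mem_closure_cross_pos hz.left_ne_right hy₀⟩,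
      Metric.isOpen_ball.inter_closure ⟨hy.1, mem_closure_cross_neg hz.left_ne_right hy₀⟩⟩

lemma eventually_mem_affineSegment_left_iff (h : cross a z b ≠ 0) :
    ∀ᶠ y in 𝓝 z, y ∈ affineSegment ℝ a z ↔
      cross a z y = 0 ∧ 0 ≤ cross a z b * cross z b y := by
  have haz : a ≠ z := by rintro rfl; simp [cross] at h
  have hcross (t : ℝ) : cross a z b * cross z b (AffineMap.lineMap a z t) =
      (1 - t) * cross a z b ^ 2 := by
    rw [cross_lineMap, cross_left, cross_rotate a z b]; ring
  have hparam : ContinuousAt (fun y => inner ℝ (z - a) (y - a) / ‖z - a‖ ^ 2) z := by fun_prop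
  have hparam_pos : 0 < inner ℝ (z - a) (z - a) / ‖z - a‖ ^ 2 := by
    have := norm_pos_iff.2 (sub_ne_zero.2 haz.symm)
    rw [real_inner_self_eq_norm_sq]; positivity
  filter_upwards [hparam.eventually_const_lt hparam_pos] with y hy
  refine ⟨fun hmem => ⟨cross_eq_zero_of_mem hmem, ?_⟩, fun ⟨hy₀, hy₁⟩ => ?_⟩
  · obtain ⟨t, ⟨-, ht⟩, rfl⟩ := hmem
    rw [hcross]
    exact mul_nonneg (sub_nonneg.2 ht) (sq_nonneg _)
  · rw [← lineMap_inner_div_of_cross_eq_zero haz hy₀, hcross] at hy₁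
    exact ⟨_, ⟨hy.le, sub_nonneg.1 (nonneg_of_mul_nonneg_left hy₁ (by positivity))⟩,
      lineMap_inner_div_of_cross_eq_zero haz hy₀⟩

lemma eventually_mem_affineSegment_right_iff (h : cross a z b ≠ 0) :
    ∀ᶠ y in 𝓝 z, y ∈ affineSegment ℝ z b ↔
      cross z b y = 0 ∧ 0 ≤ cross a z b * cross a z y := by
  have hcross : cross b z a = -cross a z b := by rw [cross_swap, cross_rotate]
  filter_upwards [eventually_mem_affineSegment_left_iff (hcross ▸ neg_ne_zero.2 h)] with y hy
  rw [affineSegment_comm, hy, hcross, cross_swap z b, cross_swap a z, neg_eq_zero, neg_mul_neg]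

/-- A vector at the corner `a z b` with equal components along the two inward normals, weighted by
the lengths of the legs; it points into the angle when `z` is a left turn. -/
def inwardDirection (a z b : Plane) : Plane := a + b - (2 : ℝ) • z

lemma cross_left_add_smul (a z b y : Plane) (δ : ℝ) :
    cross a z (y + δ • inwardDirection a z b) = cross a z y + δ * cross a z b := by
  simp only [cross, inwardDirection, PiLp.add_apply, PiLp.sub_apply, PiLp.smul_apply, smul_eq_mul]
  ring

lemma cross_right_add_smul (a z b y : Plane) (δ : ℝ) :
    cross z b (y + δ • inwardDirection a z b) = cross z b y + δ * cross a z b := by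
  simp only [cross, inwardDirection, PiLp.add_apply, PiLp.sub_apply, PiLp.smul_apply, smul_eq_mul]
  ring

lemma cross_left_add_smul_neg (a z b y : Plane) (δ : ℝ) :
    cross a z (y + δ • -inwardDirection a z b) = cross a z y - δ * cross a z b := by
  rw [smul_neg, ← neg_smul, cross_left_add_smul, neg_mul, sub_eq_add_neg]

lemma cross_right_add_smul_neg (a z b y : Plane) (δ : ℝ) :
    cross z b (y + δ • -inwardDirection a z b) = cross z b y - δ * cross a z b := by
  rw [smul_neg, ← neg_smul, cross_right_add_smul, neg_mul, sub_eq_add_neg]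

lemma isPreconnected_ball_inter_reflex_sector (h : 0 < cross a z b) {r : ℝ} (hr : 0 < r) :
    IsPreconnected (Metric.ball z r ∩ ({y | cross a z y < 0} ∪ {y | cross z b y < 0})) := by
  have hcl : z ∈ closure ({y | cross a z y < 0} ∩ {y | cross z b y < 0}) := by
    refine mem_closure_of_forall_add_smul_mem (-inwardDirection a z b) fun δ hδ => ?_
    have := mul_pos hδ h
    simp only [Set.mem_inter_iff, Set.mem_ofPred_eq, cross_left_add_smul_neg,
      cross_right_add_smul_neg, cross_left, cross_right]
    constructor <;> linarith
  obtain ⟨y, hy, hy₁, hy₂⟩ :=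
    mem_closure_iff.1 hcl _ Metric.isOpen_ball (Metric.mem_ball_self hr)
  rw [Set.inter_union_distrib_left]
  exact IsPreconnected.union y ⟨hy, hy₁⟩ ⟨hy, hy₂⟩
    ((convex_ball z r).inter (convex_cross_neg a z)).isPreconnected
    ((convex_ball z r).inter (convex_cross_neg z b)).isPreconnected

lemma isTwoSided_corner_of_cross_pos (h : 0 < cross a z b) :
    IsTwoSided (affineSegment ℝ a z ∪ affineSegment ℝ z b) z := by
  filter_upwards [eventually_mem_nhdsWithin, eventually_nhdsGT_forall_mem_ball
    ((eventually_mem_affineSegment_left_iff h.ne').and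
      (eventually_mem_affineSegment_right_iff h.ne'))] with r hr₀ hr
  simp only [mul_nonneg_iff_of_pos_left h] at hr
  refine ⟨Metric.ball z r ∩ ({y | 0 < cross a z y} ∩ {y | 0 < cross z b y}),
    Metric.ball z r ∩ ({y | cross a z y < 0} ∪ {y | cross z b y < 0}),
    ((convex_ball z r).inter ((convex_cross_pos a z).inter (convex_cross_pos z b))).isPreconnected,
    isPreconnected_ball_inter_reflex_sector h hr₀, ?_, fun y hy => ⟨?_, ?_⟩⟩
  · rw [← Set.inter_union_distrib_left]
    ext y
    refine and_congr_right fun hy => ?_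
    simp only [Set.mem_union, Set.mem_inter_iff, Set.mem_ofPred_eq, hr y hy]
    grind
  · refine Metric.isOpen_ball.inter_closure
      ⟨hy.1, mem_closure_of_forall_add_smul_mem (inwardDirection a z b) fun δ hδ => ?_⟩
    have := mul_pos hδ h
    have hΓ := hy.2
    simp only [Set.mem_union, hr y hy.1] at hΓ
    simp only [Set.mem_inter_iff, Set.mem_ofPred_eq, cross_left_add_smul, cross_right_add_smul]
    grind
  · refine Metric.isOpen_ball.inter_closure
      ⟨hy.1, mem_closure_of_forall_add_smul_mem (-inwardDirection a z b) fun δ hδ => ?_⟩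
    have := mul_pos hδ h
    have hΓ := hy.2
    simp only [Set.mem_union, hr y hy.1] at hΓ
    simp only [Set.mem_union, Set.mem_ofPred_eq, cross_left_add_smul_neg, cross_right_add_smul_neg]
    grind

lemma sbtw_of_cross_eq_zero (haz : a ≠ z) (hzb : z ≠ b) (hcross : cross a z b = 0)
    (h : affineSegment ℝ a z ∩ affineSegment ℝ z b ⊆ {z}) : Sbtw ℝ a z b := by
  have hcol : Collinear ℝ {a, z, b} := by
    rw [Set.pair_comm z b, Set.insert_comm a b]
    refine collinear_insert_of_mem_affineSpan_pair ?_
    rw [← lineMap_inner_div_of_cross_eq_zero haz hcross]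
    exact AffineMap.lineMap_mem_affineSpan_pair (k := ℝ) _ a z
  rcases hcol.wbtw_or_wbtw_or_wbtw with hw | hw | hw
  · exact ⟨hw, haz.symm, hzb⟩
  · exact absurd (h ⟨(affineSegment_comm ℝ z a).subset hw, right_mem_affineSegment ℝ z b⟩)
      hzb.symm
  · exact absurd (h ⟨left_mem_affineSegment ℝ a z, (affineSegment_comm ℝ b z).subset hw⟩) haz

lemma isTwoSided_corner (haz : a ≠ z) (hzb : z ≠ b)
    (h : affineSegment ℝ a z ∩ affineSegment ℝ z b ⊆ {z}) :
    IsTwoSided (affineSegment ℝ a z ∪ affineSegment ℝ z b) z := by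
  rcases lt_trichotomy (cross a z b) 0 with hcross | hcross | hcross
  · have hrev : 0 < cross b z a := by rwa [cross_swap, cross_rotate, neg_pos]
    rw [affineSegment_comm ℝ a, affineSegment_comm ℝ z b, Set.union_comm]
    exact isTwoSided_corner_of_cross_pos hrev
  · have hz := sbtw_of_cross_eq_zero haz hzb hcross h
    rw [affineSegment_union_of_wbtw hz.wbtw]
    exact isTwoSided_affineSegment hz
  · exact isTwoSided_corner_of_cross_pos hcross

end Boundary

end Plane

lemma isPreconnected_setOf_lt_norm {E : Type*} [NormedAddCommGroup E] [NormedSpace ℝ E]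
    (hE : 1 < Module.rank ℝ E) {M : ℝ} (hM : 0 ≤ M) : IsPreconnected {x : E | M < ‖x‖} := by
  have himage : {x : E | M < ‖x‖} =
      (fun q : ℝ × E => q.1 • q.2) '' (Set.Ioi M ×ˢ Metric.sphere 0 1) := by
    ext x
    constructor
    · intro hx
      have hx₀ : ‖x‖ ≠ 0 := (hM.trans_lt hx).ne'
      exact ⟨(‖x‖, ‖x‖⁻¹ • x), ⟨hx, by simp [norm_smul, hx₀]⟩, smul_inv_smul₀ hx₀ x⟩
    · rintro ⟨⟨r, y⟩, ⟨hr, hy⟩, rfl⟩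
      rw [mem_sphere_zero_iff_norm] at hy
      change M < ‖r • y‖
      rwa [norm_smul, hy, mul_one, Real.norm_of_nonneg (hM.trans (le_of_lt hr))]
  rw [himage]
  exact (isPreconnected_Ioi.prod (isPreconnected_sphere hE 0 1)).image _ (by fun_prop)

lemma finRotate_ne_self {n : ℕ} (hn : 3 ≤ n) (i : Fin n) : finRotate n i ≠ i := by
  obtain ⟨m, rfl⟩ := Nat.exists_eq_add_of_le' hn
  simp [finRotate_apply]

lemma finRotate_finRotate_ne_self {n : ℕ} (hn : 3 ≤ n) (i : Fin n) :
    finRotate n (finRotate n i) ≠ i := by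
  obtain ⟨m, rfl⟩ := Nat.exists_eq_add_of_le' hn
  rw [finRotate_apply, finRotate_apply, add_assoc, Ne, add_eq_left, Fin.ext_iff, Fin.val_add]
  simp only [Fin.coe_ofNat_eq_mod, Nat.zero_mod]
  rw [Nat.mod_eq_of_lt (by omega : 1 < m + 3), Nat.mod_eq_of_lt (by omega)]
  omega

namespace Plane

section Winding

variable {n : ℕ} {p : Polygon Plane n} {i j : Fin n} {x y z : Plane}

/-- The winding number of `p` around `x`, as a signed count of crossings of the upward vertical
ray from `x` with the edges. -/
def winding (p : Polygon Plane n) (x : Plane) : ℤ :=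
  ∑ i, crossing (p i) (p (finRotate n i)) x

lemma winding_eq_sum_correctedCrossing (p : Polygon Plane n) (x y : Plane) :
    winding p y = ∑ i, correctedCrossing (p i) (p (finRotate n i)) x y := by
  simp only [correctedCrossing, Finset.sum_sub_distrib, Finset.sum_add_distrib,
    Equiv.sum_comp (finRotate n) fun i => vertexTerm (p i) x y, add_sub_cancel_right, winding]

lemma notMem_boundary : x ∉ p.boundary ℝ ↔ ∀ i, x ∉ p.edgeSet ℝ i := by
  simp only [Polygon.boundary, Set.mem_iUnion, not_exists]

lemma eventually_winding_eq (hx : x ∉ p.boundary ℝ) :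
    ∀ᶠ y in 𝓝 x, winding p y = winding p x := by
  choose k hk using fun i => eventually_correctedCrossing_eq (notMem_boundary.1 hx i)
  have hsum : ∀ᶠ y in 𝓝 x, winding p y = ∑ i, k i := by
    filter_upwards [eventually_all.2 hk] with y hy
    rw [winding_eq_sum_correctedCrossing p x y]
    exact Finset.sum_congr rfl fun i _ => hy i
  filter_upwards [hsum] with y hy
  rw [hy, hsum.self_of_nhds]

lemma winding_eq_of_isPreconnected {s : Set Plane} (hs : IsPreconnected s)
    (hsub : s ⊆ (p.boundary ℝ)ᶜ) (hx : x ∈ s) (hy : y ∈ s) : winding p x = winding p y :=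
  hs.constant (f := winding p) (fun _ hz => (tendsto_const_nhds.congr'
    ((eventually_winding_eq (hsub hz)).mono fun _ h => h.symm)).mono_left nhdsWithin_le_nhds)
    hx hy

lemma winding_eq_of_connectedComponentIn_eq (hx : x ∉ p.boundary ℝ) (hy : y ∉ p.boundary ℝ)
    (h : connectedComponentIn (p.boundary ℝ)ᶜ x = connectedComponentIn (p.boundary ℝ)ᶜ y) :
    winding p x = winding p y :=
  winding_eq_of_isPreconnected isPreconnected_connectedComponentIn
    (connectedComponentIn_subset _ _) (mem_connectedComponentIn hx)
    (h.symm.subset (mem_connectedComponentIn hy))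

lemma isCompact_boundary (p : Polygon Plane n) : IsCompact (p.boundary ℝ) :=
  isCompact_iUnion fun _ => isCompact_Icc.image AffineMap.lineMap_continuous

lemma isClosed_edgeSet (p : Polygon Plane n) (i : Fin n) : IsClosed (p.edgeSet ℝ i) :=
  (isCompact_Icc.image AffineMap.lineMap_continuous).isClosed

lemma isPreconnected_boundary (p : Polygon Plane n) : IsPreconnected (p.boundary ℝ) := by
  obtain - | m := n
  · simp [Polygon.boundary, isPreconnected_empty]
  let meets (i j : Fin (m + 1)) : Prop := (p.edgeSet ℝ i ∩ p.edgeSet ℝ j).Nonempty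
  have hreach (i : Fin (m + 1)) : Relation.ReflTransGen meets 0 i := by
    induction i using Fin.induction with
    | zero => exact .refl
    | succ i ih =>
      have hi : finRotate (m + 1) i.castSucc = i.succ := by
        rw [finRotate_apply, Fin.coeSucc_eq_succ]
      refine ih.tail ⟨p i.succ, ?_, left_mem_affineSegment ℝ _ _⟩
      rw [Polygon.edgeSet, hi]
      exact right_mem_affineSegment ℝ _ _
  have hsymm : Std.Symm meets := ⟨fun i j (h : Set.Nonempty _) => by rwa [Set.inter_comm] at h⟩
  exact IsPreconnected.iUnion_of_reflTransGen
    (fun i => isPreconnected_Icc.image _ AffineMap.lineMap_continuous.continuousOn)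
    fun i j => (Relation.ReflTransGen.stdSymm.symm _ _ (hreach i)).trans (hreach j)

lemma eventually_notMem_edgeSet {Q : Fin n → Prop} (h : ∀ j, Q j → z ∉ p.edgeSet ℝ j) :
    ∀ᶠ y in 𝓝 z, ∀ j, Q j → y ∉ p.edgeSet ℝ j :=
  eventually_all.2 fun j => eventually_imp_distrib_left.2 fun hj =>
    (isClosed_edgeSet p j).isOpen_compl.mem_nhds (h j hj)

lemma vertex_ne_of_isSimple (hp : p.IsSimple) (hn : 3 ≤ n) (i : Fin n) :
    p i ≠ p (finRotate n i) :=
  fun h => finRotate_ne_self hn i (hp.1 h).symm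

lemma exists_sbtw_or_eq_vertex (hz : z ∈ p.boundary ℝ) :
    ∃ i, Sbtw ℝ (p i) z (p (finRotate n i)) ∨ z = p (finRotate n i) := by
  obtain ⟨i, hi⟩ := Set.mem_iUnion.1 hz
  by_cases hl : z = p i
  · exact ⟨(finRotate n).symm i, .inr (by rwa [Equiv.apply_symm_apply])⟩
  · exact ⟨i, or_iff_not_imp_right.2 fun hr => ⟨hi, hl, hr⟩⟩

lemma notMem_edgeSet_of_sbtw (hp : p.IsSimple) (hz : Sbtw ℝ (p i) z (p (finRotate n i)))
    (hji : j ≠ i) : z ∉ p.edgeSet ℝ j :=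
  fun hj => (hp.2 i j hji.symm ⟨hz.wbtw, hj⟩).1.elim hz.ne_left hz.ne_right

lemma exists_winding_eq_add_one_of_sbtw (hp : p.IsSimple)
    (hz : Sbtw ℝ (p i) z (p (finRotate n i))) :
    ∃ k, ∃ u ∉ p.boundary ℝ, ∃ v ∉ p.boundary ℝ, winding p u = k ∧ winding p v = k + 1 := by
  obtain ⟨k, hk⟩ := eventually_correctedCrossing_eq_of_sbtw hz
  have hoff (j) (hj : j ≠ i) : z ∉ p.edgeSet ℝ j := notMem_edgeSet_of_sbtw hp hz hj
  choose! l hl using fun j hj => eventually_correctedCrossing_eq (hoff j hj)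
  have hl' : ∀ᶠ y in 𝓝 z, ∀ j, j ≠ i →
      correctedCrossing (p j) (p (finRotate n j)) z y = l j :=
    eventually_all.2 fun j => eventually_imp_distrib_left.2 (hl j)
  set m := k + ∑ j ∈ Finset.univ.erase i, l j with hm
  have hjump : ∀ᶠ y in 𝓝 z, cross (p i) (p (finRotate n i)) y ≠ 0 → y ∉ p.boundary ℝ ∧
      winding p y = m + if 0 < cross (p i) (p (finRotate n i)) y then 1 else 0 := by
    filter_upwards [hk, hl', eventually_notMem_edgeSet hoff] with y hyi hyj hyoff hy
    refine ⟨notMem_boundary.2 fun j => ?_, ?_⟩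
    · obtain rfl | hj := eq_or_ne j i
      · exact mt cross_eq_zero_of_mem hy
      · exact hyoff j hj
    · rw [winding_eq_sum_correctedCrossing p z y, ← Finset.add_sum_erase _ _ (Finset.mem_univ i),
        hyi hy, Finset.sum_congr rfl fun j hj => hyj j (Finset.ne_of_mem_erase hj), hm]
      ring
  have hz₀ := cross_eq_zero_of_mem hz.wbtw
  obtain ⟨u, hu, hu'⟩ := mem_closure_iff_nhds.1 (mem_closure_cross_neg hz.left_ne_right hz₀) _ hjump
  obtain ⟨v, hv, hv'⟩ := mem_closure_iff_nhds.1 (mem_closure_cross_pos hz.left_ne_right hz₀) _ hjump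
  refine ⟨m, u, (hu hu'.ne).1, v, (hv hv'.ne').1, ?_, ?_⟩
  · rw [(hu hu'.ne).2, if_neg (not_lt_of_gt hu'), add_zero]
  · rw [(hv hv'.ne').2, if_pos (show 0 < cross _ _ v from hv')]

lemma isTwoSided_boundary_of_sbtw (hp : p.IsSimple) (hz : Sbtw ℝ (p i) z (p (finRotate n i))) :
    IsTwoSided (p.boundary ℝ) z := by
  refine (isTwoSided_affineSegment hz).congr ?_
  filter_upwards [eventually_notMem_edgeSet fun j => notMem_edgeSet_of_sbtw hp hz] with y hy
  refine ⟨fun h => Set.mem_iUnion.2 ⟨i, h⟩, fun h => ?_⟩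
  obtain ⟨j, hj⟩ := Set.mem_iUnion.1 h
  obtain rfl : j = i := by_contra fun hji => hy j hji hj
  exact hj

lemma isTwoSided_boundary_vertex (hp : p.IsSimple) (hn : 3 ≤ n) (i : Fin n) :
    IsTwoSided (p.boundary ℝ) (p (finRotate n i)) := by
  set j := finRotate n i with hj
  have hij : i ≠ j := (finRotate_ne_self hn i).symm
  have hoff (k) (hk : k ≠ i ∧ k ≠ j) : p j ∉ p.edgeSet ℝ k := by
    intro hmem
    rcases (hp.2 k j hk.2 ⟨hmem, left_mem_affineSegment ℝ _ _⟩).1 with h | h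
    · exact hk.2 (hp.1 h).symm
    · exact hk.1 ((finRotate n).injective (hp.1 h)).symm
  refine (isTwoSided_corner (vertex_ne_of_isSimple hp hn i) (vertex_ne_of_isSimple hp hn j)
    fun y hy => ?_).congr ?_
  · rcases hp.2 i j hij hy with ⟨hi | hi, hj' | hj'⟩
    · exact hj'
    · exact absurd (hp.1 (hi.symm.trans hj')).symm (finRotate_finRotate_ne_self hn i)
    · exact hj'
    · exact hi
  · filter_upwards [eventually_notMem_edgeSet hoff] with y hy
    refine ⟨fun h => Set.mem_iUnion.2 (h.elim (⟨i, ·⟩) (⟨j, ·⟩)), fun h => ?_⟩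
    obtain ⟨k, hk⟩ := Set.mem_iUnion.1 h
    obtain rfl | hki := eq_or_ne k i
    · exact .inl hk
    obtain rfl | hkj := eq_or_ne k j
    · exact .inr hk
    exact absurd hk (hy k ⟨hki, hkj⟩)

lemma isTwoSided_boundary (hp : p.IsSimple) (hn : 3 ≤ n) (hz : z ∈ p.boundary ℝ) :
    IsTwoSided (p.boundary ℝ) z := by
  obtain ⟨i, hi | rfl⟩ := exists_sbtw_or_eq_vertex hz
  · exact isTwoSided_boundary_of_sbtw hp hi
  · exact isTwoSided_boundary_vertex hp hn i

lemma exists_forall_connectedComponentIn_eq_or_eq (hp : p.IsSimple) (hn : 3 ≤ n) :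
    ∃ k, ∃ u ∉ p.boundary ℝ, ∃ v ∉ p.boundary ℝ, winding p u = k ∧ winding p v = k + 1 ∧
      ∀ x ∉ p.boundary ℝ,
        connectedComponentIn (p.boundary ℝ)ᶜ x = connectedComponentIn (p.boundary ℝ)ᶜ u ∨
        connectedComponentIn (p.boundary ℝ)ᶜ x = connectedComponentIn (p.boundary ℝ)ᶜ v := by
  let i : Fin n := ⟨0, by omega⟩
  obtain ⟨k, u, hu, v, hv, hku, hkv⟩ := exists_winding_eq_add_one_of_sbtw hp
    (sbtw_midpoint_of_ne ℝ (vertex_ne_of_isSimple hp hn i))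
  obtain ⟨a, -, b, -, hab⟩ := IsTwoSided.connectedComponentIn_eq_or_eq
    (isCompact_boundary p).isClosed
    ⟨⟨p i, Set.mem_iUnion.2 ⟨i, left_mem_affineSegment ℝ _ _⟩⟩, isPreconnected_boundary p⟩
    fun z => isTwoSided_boundary hp hn
  have huv : connectedComponentIn (p.boundary ℝ)ᶜ u ≠ connectedComponentIn (p.boundary ℝ)ᶜ v := by
    intro h
    have := winding_eq_of_connectedComponentIn_eq hu hv h
    omega
  refine ⟨k, u, hu, v, hv, hku, hkv, fun x hx => ?_⟩
  rcases hab u hu with h | h <;> rcases hab v hv with h' | h'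
  · exact absurd (h.trans h'.symm) huv
  · rw [h, h']; exact hab x hx
  · rw [h, h']; exact (hab x hx).symm
  · exact absurd (h.trans h'.symm) huv

lemma exists_forall_lt_norm_winding_eq_zero (p : Polygon Plane n) :
    ∃ M, ∀ x, M < ‖x‖ → x ∉ p.boundary ℝ ∧ winding p x = 0 := by
  obtain ⟨M, hM⟩ := isBounded_iff_forall_norm_le.1 (isCompact_boundary p).isBounded
  have hfar (x : Plane) (hx : max M 0 < ‖x‖) : x ∉ p.boundary ℝ :=
    fun h => (hM x h).not_gt ((le_max_left _ _).trans_lt hx)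
  set x₀ : Plane := !₂[max M 0 + 1, 0]
  have hx₀_norm : max M 0 < ‖x₀‖ :=
    (lt_add_one _).trans_le ((le_abs_self _).trans (PiLp.norm_apply_le x₀ 0))
  have hx₀_winding : winding p x₀ = 0 := by
    have hlt (i) : p i 0 < x₀ 0 := calc
      p i 0 ≤ ‖p i‖ := (le_abs_self _).trans (PiLp.norm_apply_le (p i) 0)
      _ ≤ M := hM _ (Set.mem_iUnion.2 ⟨i, left_mem_affineSegment ℝ _ _⟩)
      _ ≤ max M 0 := le_max_left _ _
      _ < x₀ 0 := lt_add_one _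
    refine Finset.sum_eq_zero fun i _ => ?_
    rw [crossing, if_neg fun h => (hlt i).not_gt h.2.1,
      if_neg fun h => (hlt (finRotate n i)).not_gt h.2.1, sub_zero]
  have hrank : 1 < Module.rank ℝ Plane := by
    rw [← Module.finrank_eq_rank, finrank_euclideanSpace_fin]; norm_num
  refine ⟨max M 0, fun x hx => ⟨hfar x hx, hx₀_winding ▸ ?_⟩⟩
  exact winding_eq_of_isPreconnected (isPreconnected_setOf_lt_norm hrank (le_max_right _ _))
    hfar hx hx₀_norm

lemma connectedComponentIn_eq_of_winding_eq (hp : p.IsSimple) (hn : 3 ≤ n)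
    (hx : x ∉ p.boundary ℝ) (hy : y ∉ p.boundary ℝ) (h : winding p x = winding p y) :
    connectedComponentIn (p.boundary ℝ)ᶜ x = connectedComponentIn (p.boundary ℝ)ᶜ y := by
  obtain ⟨k, u, hu, v, hv, hku, hkv, huv⟩ := exists_forall_connectedComponentIn_eq_or_eq hp hn
  rcases huv x hx with hxu | hxv <;> rcases huv y hy with hyu | hyv
  · exact hxu.trans hyu.symm
  · have := winding_eq_of_connectedComponentIn_eq hx hu hxu
    have := winding_eq_of_connectedComponentIn_eq hy hv hyv
    omega
  · have := winding_eq_of_connectedComponentIn_eq hx hv hxv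
    have := winding_eq_of_connectedComponentIn_eq hy hu hyu
    omega
  · exact hxv.trans hyv.symm

lemma mem_enclosedRegion_iff (hp : p.IsSimple) (hn : 3 ≤ n) (hx : x ∉ p.boundary ℝ) :
    x ∈ p.enclosedRegion ↔ winding p x ≠ 0 := by
  obtain ⟨M, hfar⟩ := exists_forall_lt_norm_winding_eq_zero p
  refine ⟨fun hxE hx₀ => ?_, fun hx₀ => ⟨hx, ?_⟩⟩
  · obtain ⟨B, hB⟩ := isBounded_iff_forall_norm_le.1 hxE.2
    obtain ⟨y, hy⟩ := NormedSpace.exists_lt_norm ℝ Plane (max M B)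
    obtain ⟨hyΓ, hy₀⟩ := hfar y ((le_max_left _ _).trans_lt hy)
    have hcomp := connectedComponentIn_eq_of_winding_eq hp hn hx hyΓ (hx₀.trans hy₀.symm)
    exact (hB y (hcomp.symm.subset (mem_connectedComponentIn hyΓ))).not_gt
      ((le_max_right _ _).trans_lt hy)
  · refine isBounded_iff_forall_norm_le.2 ⟨M, fun y hy => not_lt.1 fun hy' => hx₀ ?_⟩
    rw [← (hfar y hy').2]
    exact winding_eq_of_isPreconnected isPreconnected_connectedComponentIn
      (connectedComponentIn_subset _ _) (mem_connectedComponentIn hx) hy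

theorem exists_winding_eq_indicator (hp : p.IsSimple) (hn : 3 ≤ n) :
    ∃ s : ℤ, |s| = 1 ∧
      ∀ x ∉ p.boundary ℝ, winding p x = p.enclosedRegion.indicator (fun _ => s) x := by
  obtain ⟨k, u, hu, v, hv, hku, hkv, huv⟩ := exists_forall_connectedComponentIn_eq_or_eq hp hn
  have hval (x) (hx : x ∉ p.boundary ℝ) : winding p x = k ∨ winding p x = k + 1 :=
    (huv x hx).imp (fun h => hku ▸ winding_eq_of_connectedComponentIn_eq hx hu h)
      fun h => hkv ▸ winding_eq_of_connectedComponentIn_eq hx hv h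
  obtain ⟨M, hfar⟩ := exists_forall_lt_norm_winding_eq_zero p
  obtain ⟨y, hy⟩ := NormedSpace.exists_lt_norm ℝ Plane M
  have hk : k = 0 ∨ k = -1 := by
    have := hval y (hfar y hy).1
    have := (hfar y hy).2
    omega
  refine ⟨2 * k + 1, by obtain rfl | rfl := hk <;> rfl, fun x hx => ?_⟩
  have hxk := hval x hx
  by_cases hxE : x ∈ p.enclosedRegion
  · have := (mem_enclosedRegion_iff hp hn hx).1 hxE
    rw [Set.indicator_of_mem hxE]
    omega
  · rw [Set.indicator_of_notMem hxE]
    exact not_not.1 (mt (mem_enclosedRegion_iff hp hn hx).2 hxE)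

end Winding

/-! ### The area formula -/

section Area

variable {a b : Plane} {m : ℝ}

lemma measurableSet_below (a b : Plane) : MeasurableSet (below a b) := by
  have hcoord : Measurable fun x : Plane => x 0 := by fun_prop
  exact (measurableSet_le measurable_const hcoord).inter
    ((measurableSet_lt hcoord measurable_const).inter
      (measurableSet_lt (continuous_cross a b).measurable measurable_const))

/-- The Cartesian coordinates of a point of the plane, as a measurable equivalence with `ℝ × ℝ`,
where areas under graphs are known. -/
def coordEquiv : Plane ≃ᵐ ℝ × ℝ :=
  (MeasurableEquiv.toLp 2 (Fin 2 → ℝ)).symm.trans MeasurableEquiv.finTwoArrow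

lemma coordEquiv_apply (x : Plane) : coordEquiv x = (x 0, x 1) := rfl

lemma measurePreserving_coordEquiv : MeasurePreserving coordEquiv volume volume :=
  (EuclideanSpace.volume_preserving_symm_measurableEquiv_toLp (Fin 2)).trans
    (volume_preserving_finTwoArrow ℝ)

/-- The height at abscissa `s` of the line through `a` and `b`. If the line is vertical, the
junk value of the slope makes it `a 1`. -/
def lineHeight (a b : Plane) (s : ℝ) : ℝ :=
  a 1 + (b 1 - a 1) / (b 0 - a 0) * (s - a 0)

lemma sub_mul_lineHeight_sub (hab : a 0 < b 0) (s m : ℝ) :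
    (b 0 - a 0) * (lineHeight a b s - m) = (b 0 - s) * (a 1 - m) + (s - a 0) * (b 1 - m) := by
  have : b 0 - a 0 ≠ 0 := (sub_pos.2 hab).ne'
  unfold lineHeight
  field_simp
  ring

lemma cross_neg_iff_lt_lineHeight (hab : a 0 < b 0) (x : Plane) :
    cross a b x < 0 ↔ x 1 < lineHeight a b (x 0) := by
  have h : cross a b x = -((b 0 - a 0) * (lineHeight a b (x 0) - x 1)) := by
    rw [sub_mul_lineHeight_sub hab, cross]; ring
  rw [h, neg_lt_zero, mul_pos_iff_of_pos_left (sub_pos.2 hab), sub_pos]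

lemma le_lineHeight (hab : a 0 < b 0) (ha : m ≤ a 1) (hb : m ≤ b 1) {s : ℝ}
    (hs : s ∈ Set.Ico (a 0) (b 0)) : m ≤ lineHeight a b s := by
  rw [← sub_nonneg, ← mul_nonneg_iff_of_pos_left (sub_pos.2 hab), sub_mul_lineHeight_sub hab]
  exact add_nonneg (mul_nonneg (sub_nonneg.2 hs.2.le) (sub_nonneg.2 ha))
    (mul_nonneg (sub_nonneg.2 hs.1) (sub_nonneg.2 hb))

lemma below_inter_eq_preimage_regionBetween (hab : a 0 < b 0) (m : ℝ) :
    below a b ∩ {x | m < x 1} =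
      coordEquiv ⁻¹' regionBetween (fun _ => m) (lineHeight a b) (Set.Ico (a 0) (b 0)) := by
  ext x
  simp only [below, cross_neg_iff_lt_lineHeight hab, Set.mem_inter_iff, Set.mem_ofPred_eq,
    Set.mem_preimage, coordEquiv_apply, regionBetween, Set.mem_Ico, Set.mem_Ioo]
  tauto

lemma integral_lineHeight_sub (hab : a 0 < b 0) (m : ℝ) :
    ∫ s in (a 0)..(b 0), (lineHeight a b s - m) = (b 0 - a 0) * ((a 1 + b 1) / 2 - m) := by
  have : b 0 - a 0 ≠ 0 := (sub_pos.2 hab).ne'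
  have haffine (s : ℝ) : lineHeight a b s - m =
      (a 1 - m - (b 1 - a 1) / (b 0 - a 0) * a 0) + (b 1 - a 1) / (b 0 - a 0) * s := by
    rw [lineHeight]; ring
  simp only [haffine]
  rw [intervalIntegral.integral_add intervalIntegrable_const
      (Continuous.intervalIntegrable (by fun_prop) _ _), intervalIntegral.integral_const,
    intervalIntegral.integral_const_mul, integral_id, smul_eq_mul]
  field_simp
  ring

lemma volume_below_inter (ha : m ≤ a 1) (hb : m ≤ b 1) :
    volume (below a b ∩ {x | m < x 1}) =
      ENNReal.ofReal (max (b 0 - a 0) 0 * ((a 1 + b 1) / 2 - m)) := by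
  rcases le_or_gt (b 0) (a 0) with hab | hab
  · have hempty : below a b = ∅ :=
      Set.eq_empty_of_forall_notMem fun x hx => (hx.1.trans_lt hx.2.1).not_ge hab
    rw [hempty, Set.empty_inter, measure_empty, max_eq_right (sub_nonpos.2 hab), zero_mul,
      ENNReal.ofReal_zero]
  · have hcont : Continuous (lineHeight a b) := by unfold lineHeight; fun_prop
    rw [below_inter_eq_preimage_regionBetween hab,
      measurePreserving_coordEquiv.measure_preimage_equiv, Measure.volume_eq_prod,
      volume_regionBetween_eq_integral (integrableOn_const (by simp))
        (hcont.integrableOn_Icc.mono_set Set.Ico_subset_Icc_self) measurableSet_Ico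
        fun _ => le_lineHeight hab ha hb,
      integral_Ico_eq_integral_Ioc, ← intervalIntegral.integral_of_le hab.le,
      max_eq_left (sub_nonneg.2 hab.le), ← integral_lineHeight_sub hab]
    rfl

lemma integrableOn_indicator_below (ha : m ≤ a 1) (hb : m ≤ b 1) :
    IntegrableOn ((below a b).indicator fun _ => (1 : ℝ)) {x | m < x 1} := by
  rw [IntegrableOn, integrable_indicator_iff (measurableSet_below a b)]
  refine integrableOn_const ?_
  rw [Measure.restrict_apply (measurableSet_below a b), volume_below_inter ha hb]
  exact ENNReal.ofReal_ne_top

lemma integral_indicator_below (ha : m ≤ a 1) (hb : m ≤ b 1) :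
    ∫ x in {x | m < x 1}, (below a b).indicator (fun _ => (1 : ℝ)) x =
      max (b 0 - a 0) 0 * ((a 1 + b 1) / 2 - m) := by
  rw [integral_indicator (measurableSet_below a b), setIntegral_const, smul_eq_mul, mul_one,
    Measure.real, Measure.restrict_apply (measurableSet_below a b), volume_below_inter ha hb,
    ENNReal.toReal_ofReal (mul_nonneg (le_max_right _ _) (by linarith))]

lemma crossing_eq_indicator_sub (a b x : Plane) :
    (crossing a b x : ℝ) =
      (below b a).indicator (fun _ => 1) x - (below a b).indicator (fun _ => 1) x := by
  by_cases ha : x ∈ below b a <;> by_cases hb : x ∈ below a b <;> simp [crossing, ha, hb]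

lemma integrableOn_crossing (ha : m ≤ a 1) (hb : m ≤ b 1) :
    IntegrableOn (fun x => (crossing a b x : ℝ)) {x | m < x 1} := by
  simp only [crossing_eq_indicator_sub]
  exact (integrableOn_indicator_below hb ha).sub (integrableOn_indicator_below ha hb)

lemma integral_crossing (ha : m ≤ a 1) (hb : m ≤ b 1) :
    ∫ x in {x | m < x 1}, (crossing a b x : ℝ) = (a 0 - b 0) * ((a 1 + b 1) / 2 - m) := by
  simp only [crossing_eq_indicator_sub]
  rw [integral_sub (integrableOn_indicator_below hb ha) (integrableOn_indicator_below ha hb),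
    integral_indicator_below hb ha, integral_indicator_below ha hb]
  rcases le_total (a 0) (b 0) with h | h
  · rw [max_eq_right (by linarith), max_eq_left (by linarith)]; ring
  · rw [max_eq_left (by linarith), max_eq_right (by linarith)]; ring

lemma volume_affineSegment (a b : Plane) : volume (affineSegment ℝ a b) = 0 := by
  have hline : line[ℝ, a, b] ≠ ⊤ := fun h => by
    have hrank := collinear_iff_finrank_le_one.1 (collinear_pair ℝ a b)
    rw [← direction_affineSpan, h, AffineSubspace.direction_top, finrank_top,
      finrank_euclideanSpace_fin] at hrank
    exact absurd hrank (by norm_num)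
  refine measure_mono_null ?_ (Measure.addHaar_affineSubspace volume _ hline)
  rintro _ ⟨t, -, rfl⟩
  exact AffineMap.lineMap_mem_affineSpan_pair t a b

variable {n : ℕ} {p : Polygon Plane n}

/-- The signed area of a closed polygon given by the shoelace formula, positive for a convex
polygon traversed counterclockwise. -/
def shoelace (p : Polygon Plane n) : ℝ :=
  ∑ i, (p i 0 * p (finRotate n i) 1 - p i 1 * p (finRotate n i) 0) / 2

lemma ae_notMem_boundary (p : Polygon Plane n) : ∀ᵐ x, x ∉ p.boundary ℝ :=
  measure_eq_zero_iff_ae_notMem.1 (measure_iUnion_null fun _ => volume_affineSegment _ _)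

lemma measurable_winding (p : Polygon Plane n) : Measurable (winding p) :=
  Finset.measurable_sum _ fun _ _ =>
    (Measurable.ite (measurableSet_below _ _) measurable_const measurable_const).sub
      (Measurable.ite (measurableSet_below _ _) measurable_const measurable_const)

lemma integral_winding (hm : ∀ i, m ≤ p i 1) :
    ∫ x in {x | m < x 1}, (winding p x : ℝ) = shoelace p := by
  let f (i : Fin n) : ℝ := p i 0 * p i 1 / 2 - m * p i 0
  -- The terms differ from those of the shoelace sum by a telescoping difference.
  have hterm (i : Fin n) :
      ∫ x in {x | m < x 1}, (crossing (p i) (p (finRotate n i)) x : ℝ) =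
        (p i 0 * p (finRotate n i) 1 - p i 1 * p (finRotate n i) 0) / 2 +
          (f i - f (finRotate n i)) := by
    rw [integral_crossing (hm i) (hm _)]; ring
  simp only [winding, Int.cast_sum]
  rw [integral_finsetSum _ fun i _ => integrableOn_crossing (hm i) (hm _)]
  simp only [hterm]
  rw [Finset.sum_add_distrib, Finset.sum_sub_distrib, Equiv.sum_comp (finRotate n) f, sub_self,
    add_zero, shoelace]

lemma measurableSet_enclosedRegion (hp : p.IsSimple) (hn : 3 ≤ n) :
    MeasurableSet p.enclosedRegion := by
  have heq : p.enclosedRegion = (p.boundary ℝ)ᶜ ∩ winding p ⁻¹' {0}ᶜ := by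
    ext x
    by_cases hx : x ∈ p.boundary ℝ
    · simp [Polygon.enclosedRegion, hx]
    · simp [mem_enclosedRegion_iff hp hn hx, hx]
  rw [heq]
  exact (isCompact_boundary p).measurableSet.compl.inter
    (measurable_winding p (measurableSet_singleton 0).compl)

lemma isBounded_enclosedRegion (hp : p.IsSimple) (hn : 3 ≤ n) :
    Bornology.IsBounded p.enclosedRegion := by
  obtain ⟨M, hM⟩ := exists_forall_lt_norm_winding_eq_zero p
  refine isBounded_iff_forall_norm_le.2 ⟨M, fun x hx => le_of_not_gt fun h => ?_⟩
  exact (mem_enclosedRegion_iff hp hn hx.1).1 hx (hM x h).2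

lemma exists_lt_of_mem_enclosedRegion (hp : p.IsSimple) (hn : 3 ≤ n) :
    ∃ m : ℝ, (∀ i, m ≤ p i 1) ∧ p.enclosedRegion ⊆ {x | m < x 1} := by
  obtain ⟨M, hM⟩ := isBounded_iff_forall_norm_le.1 (isBounded_enclosedRegion hp hn)
  obtain ⟨c, hc⟩ := (Set.finite_range fun i => p i 1).bddBelow
  refine ⟨min c (-M - 1), fun i => (min_le_left _ _).trans (hc ⟨i, rfl⟩), fun x hx => ?_⟩
  have hle : -M ≤ x 1 := neg_le_of_abs_le ((PiLp.norm_apply_le x 1).trans (hM x hx))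
  exact (min_le_right _ _).trans_lt (by linarith : -M - 1 < x 1)

theorem area_eq_ofReal_abs_shoelace (hp : p.IsSimple) (hn : 3 ≤ n) :
    p.area = ENNReal.ofReal |shoelace p| := by
  obtain ⟨s, hs, hwind⟩ := exists_winding_eq_indicator hp hn
  obtain ⟨m, hm, hregion⟩ := exists_lt_of_mem_enclosedRegion hp hn
  have hae : ∀ᵐ x, (winding p x : ℝ) = p.enclosedRegion.indicator (fun _ => (s : ℝ)) x := by
    filter_upwards [ae_notMem_boundary p] with x hx
    rw [hwind x hx]
    exact map_indicator (Int.castAddHom ℝ) p.enclosedRegion _ x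
  have hint : shoelace p = volume.real p.enclosedRegion * s := by
    rw [← integral_winding hm, integral_congr_ae (ae_restrict_of_ae hae),
      setIntegral_indicator (measurableSet_enclosedRegion hp hn),
      Set.inter_eq_right.2 hregion, setIntegral_const, smul_eq_mul]
  rw [hint, abs_mul, ← Int.cast_abs, hs, Int.cast_one, mul_one, abs_of_nonneg measureReal_nonneg,
    ofReal_measureReal (isBounded_enclosedRegion hp hn).measure_lt_top.ne, Polygon.area]

end Area

end Plane

namespace PlanarPath

lemma re_circleExp (x : ℝ) : (Circle.exp x : ℂ).re = Real.cos x := by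
  rw [Circle.coe_exp, Complex.exp_ofReal_mul_I_re]

lemma im_circleExp (x : ℝ) : (Circle.exp x : ℂ).im = Real.sin x := by
  rw [Circle.coe_exp, Complex.exp_ofReal_mul_I_im]

lemma circleExp_two_mul_sub_one (x : ℝ) :
    (Circle.exp (2 * x) : ℂ) - 1 = 2 * Complex.I * Real.sin x * Circle.exp x := by
  apply Complex.ext <;>
    simp only [Complex.sub_re, Complex.sub_im, Complex.mul_re, Complex.mul_im, Complex.one_re,
      Complex.one_im, Complex.I_re, Complex.I_im, Complex.re_ofNat, Complex.im_ofNat,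
      Complex.ofReal_re, Complex.ofReal_im, re_circleExp, im_circleExp, Real.sin_two_mul,
      Real.cos_two_mul, Real.cos_sq'] <;>
    ring

lemma norm_circleExp_sub (x y : ℝ) :
    ‖(Circle.exp (2 * x) : ℂ) - Circle.exp (2 * y)‖ = 2 * |Real.sin (x - y)| := by
  have h : (Circle.exp (2 * x) : ℂ) - Circle.exp (2 * y) =
      Circle.exp (2 * y) * (Circle.exp (2 * (x - y)) - 1) := by
    rw [mul_sub, mul_one, ← Circle.coe_mul, ← Circle.exp_add]
    ring_nf
  rw [h, circleExp_two_mul_sub_one, norm_mul, norm_mul, norm_mul, norm_mul, Circle.norm_coe,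
    Circle.norm_coe, Complex.norm_I, Complex.norm_ofNat, Complex.norm_real, Real.norm_eq_abs]
  ring

/-- The determinant of two complex numbers, regarded as vectors in the plane. -/
def wedge (z w : ℂ) : ℝ := z.re * w.im - z.im * w.re

/-- The length of the first `n` edges of the polygonal path with vertices `u 0, u 1, …`. -/
def length (n : ℕ) (u : ℕ → ℂ) : ℝ := ∑ k ∈ Finset.range n, ‖u (k + 1) - u k‖

/-- The sum of the squared lengths of the first `n` edges of a polygonal path. -/
def energy (n : ℕ) (u : ℕ → ℂ) : ℝ := ∑ k ∈ Finset.range n, ‖u (k + 1) - u k‖ ^ 2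

/-- The signed area of the closed polygon with vertices `u 0, …, u n`, as a sum over the triangles
with apex `u 0`. -/
def area (n : ℕ) (u : ℕ → ℂ) : ℝ :=
  ∑ k ∈ Finset.range n, wedge (u k - u 0) (u (k + 1) - u 0) / 2

/-- The first `n` edges of the path have equal lengths. -/
def IsEquilateral (n : ℕ) (u : ℕ → ℂ) : Prop :=
  ∀ k, k + 1 < n → ‖u (k + 1) - u k‖ = ‖u (k + 2) - u (k + 1)‖

/-- The vertices `u 0, …, u n` lie on a circle, and each edge subtends the angle `2θ` at its
center. -/
def IsRegularArc (θ : ℝ) (n : ℕ) (u : ℕ → ℂ) : Prop :=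
  ∃ c v : ℂ, ∀ k ≤ n, u k = c + Circle.exp (2 * (k * θ)) * v

section Energy

variable {θ : ℝ} {n : ℕ} {u : ℕ → ℂ}

lemma cot_add_cot {α β : ℝ} (hα : Real.sin α ≠ 0) (hβ : Real.sin β ≠ 0) :
    Real.cot α + Real.cot β = Real.sin (α + β) / (Real.sin α * Real.sin β) := by
  rw [Real.cot_eq_cos_div_sin, Real.cot_eq_cos_div_sin, Real.sin_add]
  field_simp
  ring

lemma cot_sub_cot {α β : ℝ} (hα : Real.sin α ≠ 0) (hβ : Real.sin β ≠ 0) :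
    Real.cot α - Real.cot β = Real.sin (β - α) / (Real.sin α * Real.sin β) := by
  rw [Real.cot_eq_cos_div_sin, Real.cot_eq_cos_div_sin, Real.sin_sub]
  field_simp

lemma norm_sub_sq_eq (p q : ℂ) (a b θ : ℝ) :
    ‖(a * Circle.exp θ * p - b * q : ℂ)‖ ^ 2 =
      a ^ 2 * ‖p‖ ^ 2 + b ^ 2 * ‖q‖ ^ 2 -
        2 * a * b * (Real.cos θ * (p.re * q.re + p.im * q.im) + Real.sin θ * wedge p q) := by
  simp only [Complex.sq_norm, Complex.normSq_apply, wedge, Complex.sub_re, Complex.sub_im,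
    Complex.mul_re, Complex.mul_im, Complex.ofReal_re, Complex.ofReal_im, re_circleExp,
    im_circleExp]
  linear_combination a ^ 2 * (p.re ^ 2 + p.im ^ 2) * Real.sin_sq_add_cos_sq θ

lemma cot_mul_norm_sub_sq {α θ : ℝ} (hα : Real.sin α ≠ 0) (hθ : Real.sin θ ≠ 0)
    (hαθ : Real.sin (α + θ) ≠ 0) (p q : ℂ) :
    Real.cot θ * ‖q - p‖ ^ 2 =
      2 * wedge p q + Real.cot (α + θ) * ‖q‖ ^ 2 - Real.cot α * ‖p‖ ^ 2 +
        ‖(Real.sin (α + θ) * Circle.exp θ * p - Real.sin α * q : ℂ)‖ ^ 2 /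
          (Real.sin α * Real.sin (α + θ) * Real.sin θ) := by
  have hp := cot_add_cot hα hθ
  have hq := cot_sub_cot hθ hαθ
  rw [add_sub_cancel_right] at hq
  have hqp : ‖q - p‖ ^ 2 = ‖q‖ ^ 2 + ‖p‖ ^ 2 - 2 * (p.re * q.re + p.im * q.im) := by
    simp only [Complex.sq_norm, Complex.normSq_apply, Complex.sub_re, Complex.sub_im]
    ring
  have hcross : ‖(Real.sin (α + θ) * Circle.exp θ * p - Real.sin α * q : ℂ)‖ ^ 2 /
      (Real.sin α * Real.sin (α + θ) * Real.sin θ) =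
      Real.sin (α + θ) / (Real.sin α * Real.sin θ) * ‖p‖ ^ 2 +
        Real.sin α / (Real.sin θ * Real.sin (α + θ)) * ‖q‖ ^ 2 -
        2 * (Real.cot θ * (p.re * q.re + p.im * q.im) + wedge p q) := by
    rw [norm_sub_sq_eq, Real.cot_eq_cos_div_sin]
    field_simp
  rw [hcross, hqp, ← hp, ← hq]
  ring

/-- The amount by which the `k`-th edge, seen from `u 0`, contributes too much energy: a weighted
square which vanishes when `u (k + 1)` is placed as in a regular arc through `u 0` and `u k`. -/
def defect (θ : ℝ) (u : ℕ → ℂ) (k : ℕ) : ℝ :=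
  ‖(Real.sin (k * θ + θ) * Circle.exp θ * (u k - u 0) -
      Real.sin (k * θ) * (u (k + 1) - u 0) : ℂ)‖ ^ 2 /
    (Real.sin (k * θ) * Real.sin (k * θ + θ) * Real.sin θ)

lemma sin_natCast_mul_pos {k : ℕ} (hθ : 0 < θ) (hn : n * θ < Real.pi) (hk0 : 0 < k) (hk : k ≤ n) :
    0 < Real.sin (k * θ) :=
  Real.sin_pos_of_pos_of_lt_pi (by positivity) (lt_of_le_of_lt (by gcongr) hn)

lemma defect_denom_pos {k : ℕ} (hθ : 0 < θ) (hn : n * θ < Real.pi) (hk0 : 0 < k) (hk : k < n) :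
    0 < Real.sin (k * θ) * Real.sin (k * θ + θ) * Real.sin θ := by
  have hsucc : ((k + 1 : ℕ) : ℝ) * θ = k * θ + θ := by push_cast; ring
  have hsin : 0 < Real.sin (k * θ) := sin_natCast_mul_pos hθ hn hk0 hk.le
  have hsin' : 0 < Real.sin (k * θ + θ) :=
    hsucc ▸ sin_natCast_mul_pos hθ hn k.succ_pos hk
  have hsinθ : 0 < Real.sin θ := by
    simpa using sin_natCast_mul_pos (k := 1) hθ hn one_pos (hk0.trans_le hk.le)
  positivity

lemma cot_mul_norm_edge_sq {k : ℕ} (hθ : 0 < θ) (hn : n * θ < Real.pi) (hk : k < n) :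
    Real.cot θ * ‖u (k + 1) - u k‖ ^ 2 =
      4 * (wedge (u k - u 0) (u (k + 1) - u 0) / 2) +
        (Real.cot ((k + 1 : ℕ) * θ) * ‖u (k + 1) - u 0‖ ^ 2 -
          Real.cot (k * θ) * ‖u k - u 0‖ ^ 2) + defect θ u k := by
  rcases k.eq_zero_or_pos with rfl | hk0
  · simp [defect, wedge]
  have hsucc : ((k + 1 : ℕ) : ℝ) * θ = k * θ + θ := by push_cast; ring
  have hdenom := (defect_denom_pos hθ hn hk0 hk).ne'
  rw [← sub_sub_sub_cancel_right (u (k + 1)) (u k) (u 0),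
    cot_mul_norm_sub_sq (left_ne_zero_of_mul (left_ne_zero_of_mul hdenom))
      (right_ne_zero_of_mul hdenom) (right_ne_zero_of_mul (left_ne_zero_of_mul hdenom)),
    hsucc, defect]
  ring

theorem cot_mul_energy_eq (hθ : 0 < θ) (hn : n * θ < Real.pi) :
    Real.cot θ * energy n u =
      4 * area n u + Real.cot (n * θ) * ‖u n - u 0‖ ^ 2 + ∑ k ∈ Finset.range n, defect θ u k := by
  have htelescope := Finset.sum_range_sub (fun k : ℕ => Real.cot (k * θ) * ‖u k - u 0‖ ^ 2) n
  rw [energy, Finset.mul_sum, Finset.sum_congr rfl fun k hk =>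
    cot_mul_norm_edge_sq hθ hn (Finset.mem_range.1 hk), Finset.sum_add_distrib,
    Finset.sum_add_distrib, htelescope, area, Finset.mul_sum, sub_self, norm_zero,
    zero_pow two_ne_zero, mul_zero, sub_zero]

lemma defect_nonneg {k : ℕ} (hθ : 0 < θ) (hn : n * θ < Real.pi) (hk : k < n) :
    0 ≤ defect θ u k := by
  rcases k.eq_zero_or_pos with rfl | hk0
  · simp [defect]
  · exact div_nonneg (sq_nonneg _) (defect_denom_pos hθ hn hk0 hk).le

theorem four_mul_area_add_le (hθ : 0 < θ) (hn : n * θ < Real.pi) :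
    4 * area n u + Real.cot (n * θ) * ‖u n - u 0‖ ^ 2 ≤ Real.cot θ * energy n u := by
  rw [cot_mul_energy_eq hθ hn]
  exact le_add_of_nonneg_right
    (Finset.sum_nonneg fun k hk => defect_nonneg hθ hn (Finset.mem_range.1 hk))

lemma sub_eq_of_defect_eq_zero (hθ : 0 < θ) (hn : n * θ < Real.pi)
    (h : ∀ k < n, defect θ u k = 0) {k : ℕ} (hk0 : 0 < k) (hk : k ≤ n) :
    (Real.sin θ * Circle.exp θ * (u k - u 0) : ℂ) =
      Real.sin (k * θ) * Circle.exp (k * θ) * (u 1 - u 0) := by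
  induction k, hk0 using Nat.le_induction with
  | base => simp
  | succ k hk0 ih =>
    have hdenom := (defect_denom_pos hθ hn hk0 hk).ne'
    have hstep : (Real.sin (k * θ + θ) * Circle.exp θ * (u k - u 0) : ℂ) =
        Real.sin (k * θ) * (u (k + 1) - u 0) := by
      have := h k hk
      rwa [defect, div_eq_zero_iff, or_iff_left hdenom, sq_eq_zero_iff, norm_eq_zero,
        sub_eq_zero] at this
    have hsin : (Real.sin (k * θ) : ℂ) ≠ 0 := by
      exact_mod_cast left_ne_zero_of_mul (left_ne_zero_of_mul hdenom)
    rw [Nat.cast_add_one, add_one_mul, Circle.exp_add, Circle.coe_mul]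
    refine mul_left_cancel₀ hsin ?_
    linear_combination -Real.sin θ * Circle.exp θ * hstep +
      Real.sin (k * θ + θ) * Circle.exp θ * ih (Nat.le_of_succ_le hk)

theorem isRegularArc_of_four_mul_area_add_eq (hθ : 0 < θ) (hn : n * θ < Real.pi)
    (h : 4 * area n u + Real.cot (n * θ) * ‖u n - u 0‖ ^ 2 = Real.cot θ * energy n u) :
    IsRegularArc θ n u := by
  have hdefect : ∀ k < n, defect θ u k = 0 := by
    have hsum : ∑ k ∈ Finset.range n, defect θ u k = 0 := by
      linarith [cot_mul_energy_eq (u := u) hθ hn]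
    simpa using (Finset.sum_eq_zero_iff_of_nonneg fun k hk =>
      defect_nonneg hθ hn (Finset.mem_range.1 hk)).1 hsum
  set v : ℂ := (u 1 - u 0) / (Circle.exp (2 * θ) - 1) with hv
  suffices hvert : ∀ k ≤ n, u k - u 0 = (Circle.exp (2 * (k * θ)) - 1) * v from
    ⟨u 0 - v, v, fun k hk => by linear_combination hvert k hk⟩
  intro k hk
  rcases k.eq_zero_or_pos with rfl | hk0
  · simp
  have hsin : (Real.sin θ : ℂ) ≠ 0 := by
    exact_mod_cast (by simpa using sin_natCast_mul_pos (k := 1) hθ hn one_pos (hk0.trans_le hk) :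
      0 < Real.sin θ).ne'
  have hne : (Circle.exp θ : ℂ) ≠ 0 := Circle.coe_ne_zero _
  rw [hv, circleExp_two_mul_sub_one, circleExp_two_mul_sub_one]
  field_simp
  linear_combination sub_eq_of_defect_eq_zero hθ hn hdefect hk0 hk

end Energy

section Adjust

variable {P Q X z : ℂ}

lemma norm_half_add_sq (z : ℂ) : ‖1 / 2 + z‖ ^ 2 = (1 / 2 + z.re) ^ 2 + z.im ^ 2 := by
  rw [Complex.sq_norm, Complex.normSq_apply]
  simp [sq]

lemma norm_half_sub_sq (z : ℂ) : ‖1 / 2 - z‖ ^ 2 = (1 / 2 - z.re) ^ 2 + z.im ^ 2 := by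
  rw [Complex.sq_norm, Complex.normSq_apply]
  simp [sq]

lemma norm_half_sub_ofReal_mul_I (b : ℝ) :
    ‖(1 / 2 - b * Complex.I : ℂ)‖ = ‖(1 / 2 + b * Complex.I : ℂ)‖ := by
  rw [← sq_eq_sq₀ (norm_nonneg _) (norm_nonneg _), norm_half_add_sq, norm_half_sub_sq]
  simp

lemma two_mul_norm_half_add_im_le (z : ℂ) :
    2 * ‖(1 / 2 + z.im * Complex.I : ℂ)‖ ≤ ‖1 / 2 + z‖ + ‖1 / 2 - z‖ := by
  have hsum : (1 / 2 + z) + (starRingEnd ℂ) (1 / 2 - z) = 2 * (1 / 2 + z.im * Complex.I) := by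
    have him := Complex.sub_conj z
    rw [map_sub, map_div₀, map_one, map_ofNat]
    push_cast at him
    linear_combination him
  rw [← Complex.norm_conj (1 / 2 - z), ← Complex.norm_ofNat, ← norm_mul, ← hsum]
  exact norm_add_le _ _

lemma two_mul_norm_half_add_im_lt (hre : z.re ≠ 0) (him : z.im ≠ 0) :
    2 * ‖(1 / 2 + z.im * Complex.I : ℂ)‖ < ‖1 / 2 + z‖ + ‖1 / 2 - z‖ := by
  refine (two_mul_norm_half_add_im_le z).lt_of_ne fun heq => ?_
  have hM := norm_half_add_sq (z.im * Complex.I)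
  have hadd := norm_half_add_sq z
  have hsub := norm_half_sub_sq z
  simp only [Complex.mul_re, Complex.mul_im, Complex.ofReal_re, Complex.ofReal_im, Complex.I_re,
    Complex.I_im] at hM
  set A := ‖1 / 2 + z‖
  set B := ‖1 / 2 - z‖
  set M := ‖(1 / 2 + z.im * Complex.I : ℂ)‖
  have hdiff : A ^ 2 - B ^ 2 = 2 * z.re := by linear_combination hadd - hsub
  have hdiff_sq : (A - B) ^ 2 = 4 * z.re ^ 2 := by
    linear_combination 2 * hadd + 2 * hsub - 4 * hM + (A + B + 2 * M) * heq
  have : z.re ^ 2 * z.im ^ 2 = 0 := by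
    linear_combination (A ^ 2 - B ^ 2 + 2 * z.re) / 16 * hdiff - (A + B) ^ 2 / 16 * hdiff_sq
      - z.re ^ 2 * hM + z.re ^ 2 / 4 * (A + B + 2 * M) * heq
  simp_all

/-- The point with coordinate `z` in the frame in which `P` and `Q` are at `-1/2` and `1/2`. -/
def framePoint (P Q z : ℂ) : ℂ := (P + Q) / 2 + z * (Q - P)

lemma exists_eq_framePoint (h : P ≠ Q) (X : ℂ) : ∃ z, X = framePoint P Q z := by
  have h' : Q - P ≠ 0 := sub_ne_zero.2 h.symm
  exact ⟨(X - (P + Q) / 2) / (Q - P), by rw [framePoint, div_mul_cancel₀ _ h', add_sub_cancel]⟩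

lemma framePoint_sub (P Q z : ℂ) : framePoint P Q z - P = (1 / 2 + z) * (Q - P) := by
  rw [framePoint]; ring

lemma sub_framePoint (P Q z : ℂ) : Q - framePoint P Q z = (1 / 2 - z) * (Q - P) := by
  rw [framePoint]; ring

lemma wedge_framePoint (P Q z : ℂ) :
    wedge (framePoint P Q z - P) (Q - framePoint P Q z) = -z.im * ‖Q - P‖ ^ 2 := by
  rw [framePoint_sub, sub_framePoint, Complex.sq_norm, Complex.normSq_apply]
  simp only [wedge, Complex.mul_re, Complex.mul_im, Complex.add_re, Complex.add_im, Complex.sub_re,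
    Complex.sub_im]
  norm_num
  ring

lemma exists_eq_framePoint_of_norm_ne (h : ‖X - P‖ ≠ ‖Q - X‖) :
    ∃ z : ℂ, z.re ≠ 0 ∧ 0 < ‖Q - P‖ ∧ X = framePoint P Q z := by
  have hPQ : P ≠ Q := by rintro rfl; exact h (norm_sub_rev _ _)
  obtain ⟨z, rfl⟩ := exists_eq_framePoint hPQ X
  refine ⟨z, fun hz => h ?_, norm_pos_iff.2 (sub_ne_zero.2 hPQ.symm), rfl⟩
  rw [framePoint_sub, sub_framePoint, norm_mul, norm_mul,
    (sq_eq_sq₀ (norm_nonneg _) (norm_nonneg _)).1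
      ((norm_half_add_sq z).trans (by rw [hz, norm_half_sub_sq, hz]; ring))]

lemma exists_balanced_of_norm_ne (h : ‖X - P‖ ≠ ‖Q - X‖) :
    ∃ Y : ℂ, wedge (Y - P) (Q - Y) = wedge (X - P) (Q - X) ∧
      ‖Y - P‖ + ‖Q - Y‖ ≤ ‖X - P‖ + ‖Q - X‖ ∧
      ‖Y - P‖ ^ 2 + ‖Q - Y‖ ^ 2 < ‖X - P‖ ^ 2 + ‖Q - X‖ ^ 2 := by
  obtain ⟨z, hz, hd, rfl⟩ := exists_eq_framePoint_of_norm_ne h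
  refine ⟨framePoint P Q (z.im * Complex.I), ?_, ?_, ?_⟩
  · simp [wedge_framePoint]
  · simp only [framePoint_sub, sub_framePoint, norm_mul, norm_half_sub_ofReal_mul_I]
    nlinarith [two_mul_norm_half_add_im_le z]
  · simp only [framePoint_sub, sub_framePoint, norm_mul, mul_pow, norm_half_add_sq,
      norm_half_sub_sq, ← add_mul]
    refine mul_lt_mul_of_pos_right ?_ (pow_pos hd 2)
    simp only [Complex.re_ofReal_mul, Complex.im_ofReal_mul, Complex.I_re, Complex.I_im]
    nlinarith [sq_pos_of_ne_zero hz]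

lemma exists_wedge_gain_of_norm_ne {κ : ℝ} (hκ : 0 < κ) (h : ‖X - P‖ ≠ ‖Q - X‖) :
    ∃ (Y : ℂ) (g : ℝ), 0 ≤ g ∧ g ≤ 1 ∧ wedge (Y - P) (Q - Y) = wedge (X - P) (Q - X) + g ∧
      ‖Y - P‖ + ‖Q - Y‖ < ‖X - P‖ + ‖Q - X‖ + κ * g := by
  obtain ⟨z, hz, hd, rfl⟩ := exists_eq_framePoint_of_norm_ne h
  rcases ne_or_eq z.im 0 with him | him
  · refine ⟨framePoint P Q (z.im * Complex.I), 0, le_rfl, zero_le_one, ?_, ?_⟩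
    · simp [wedge_framePoint]
    · simp only [framePoint_sub, sub_framePoint, norm_mul, norm_half_sub_ofReal_mul_I]
      nlinarith [two_mul_norm_half_add_im_lt hz him]
  -- Bending a straight pair of edges by `η` costs length of order `η²` but gains area of order `η`.
  · set d := ‖Q - P‖
    set η := min (κ * d / 4) (1 / d ^ 2)
    have hη : 0 < η := lt_min (by positivity) (by positivity)
    have hηκ : η ≤ κ * d / 4 := min_le_left _ _
    have hηd : η * d ^ 2 ≤ 1 := (le_div_iff₀ (by positivity)).1 (min_le_right _ _)
    refine ⟨framePoint P Q ((-η : ℝ) * Complex.I), η * d ^ 2, by positivity, hηd, ?_, ?_⟩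
    · simp [wedge_framePoint, him, d]
    have hbend : 2 * ‖(1 / 2 + (-η : ℝ) * Complex.I : ℂ)‖ ≤ 1 + 2 * η ^ 2 := by
      rw [← sq_le_sq₀ (by positivity) (by positivity), mul_pow, norm_half_add_sq]
      simp only [Complex.re_ofReal_mul, Complex.im_ofReal_mul, Complex.I_re, Complex.I_im]
      nlinarith [sq_nonneg (η ^ 2)]
    have hlen : 1 ≤ ‖1 / 2 + z‖ + ‖1 / 2 - z‖ := by
      simpa [him] using two_mul_norm_half_add_im_le z
    simp only [framePoint_sub, sub_framePoint, norm_mul, norm_half_sub_ofReal_mul_I]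
    nlinarith [mul_pos hη hd]

end Adjust

section Equilateral

variable {n k : ℕ} {u : ℕ → ℂ}

lemma sum_update (f : ℂ → ℂ → ℝ) (hk : k + 1 < n) (u : ℕ → ℂ) (X : ℂ) :
    ∑ j ∈ Finset.range n,
        f (Function.update u (k + 1) X j) (Function.update u (k + 1) X (j + 1)) =
      ∑ j ∈ Finset.range n, f (u j) (u (j + 1)) + (f (u k) X + f X (u (k + 2)) -
        (f (u k) (u (k + 1)) + f (u (k + 1)) (u (k + 2)))) := by
  rw [← sub_eq_iff_eq_add', ← Finset.sum_sub_distrib, Finset.sum_eq_add k (k + 1)]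
  · simp only [ne_eq, Nat.left_eq_add, one_ne_zero, not_false_eq_true, Function.update_of_ne,
      Function.update_self, Nat.add_eq_left]
    ring
  · simp
  · rintro j - ⟨hj, hj'⟩
    rw [Function.update_of_ne hj', Function.update_of_ne (by omega), sub_self]
  · exact fun h => absurd (Finset.mem_range.2 (by omega)) h
  · exact fun h => absurd (Finset.mem_range.2 hk) h

lemma length_update (hk : k + 1 < n) (u : ℕ → ℂ) (X : ℂ) :
    length n (Function.update u (k + 1) X) = length n u +
      (‖X - u k‖ + ‖u (k + 2) - X‖ - (‖u (k + 1) - u k‖ + ‖u (k + 2) - u (k + 1)‖)) :=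
  sum_update (fun z w => ‖w - z‖) hk u X

lemma energy_update (hk : k + 1 < n) (u : ℕ → ℂ) (X : ℂ) :
    energy n (Function.update u (k + 1) X) = energy n u +
      (‖X - u k‖ ^ 2 + ‖u (k + 2) - X‖ ^ 2 -
        (‖u (k + 1) - u k‖ ^ 2 + ‖u (k + 2) - u (k + 1)‖ ^ 2)) :=
  sum_update (fun z w => ‖w - z‖ ^ 2) hk u X

lemma area_update (hk : k + 1 < n) (u : ℕ → ℂ) (X : ℂ) :
    area n (Function.update u (k + 1) X) = area n u +
      (wedge (X - u k) (u (k + 2) - X) -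
        wedge (u (k + 1) - u k) (u (k + 2) - u (k + 1))) / 2 := by
  have h := sum_update (fun z w => wedge (z - u 0) (w - u 0) / 2) hk u X
  rw [area, Function.update_of_ne (k.succ_ne_zero).symm, h, area]
  simp only [wedge, Complex.sub_re, Complex.sub_im]
  ring

lemma length_nonneg (n : ℕ) (u : ℕ → ℂ) : 0 ≤ length n u :=
  Finset.sum_nonneg fun _ _ => norm_nonneg _

lemma norm_sub_le_length (hk : k ≤ n) (u : ℕ → ℂ) : ‖u k - u 0‖ ≤ length n u := by
  rw [← Finset.sum_range_sub]
  exact (norm_sum_le _ _).trans (Finset.sum_le_sum_of_subset_of_nonneg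
    (Finset.range_subset_range.2 hk) fun _ _ _ => norm_nonneg _)

lemma continuous_length (n : ℕ) : Continuous (length n) := by unfold length; fun_prop

lemma continuous_energy (n : ℕ) : Continuous (energy n) := by unfold energy; fun_prop

lemma continuous_area (n : ℕ) : Continuous (area n) := by unfold area wedge; fun_prop

/-- The paths with the endpoints of `u` which enclose at least as much area as `u` and are at most
as long. -/
def improvements (n : ℕ) (u : ℕ → ℂ) : Set (ℕ → ℂ) :=
  {m | m 0 = u 0 ∧ (∀ k ≥ n, m k = u k) ∧ area n u ≤ area n m ∧ length n m ≤ length n u}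

lemma isCompact_improvements (n : ℕ) (u : ℕ → ℂ) : IsCompact (improvements n u) := by
  have hball : IsCompact (Set.univ.pi fun k =>
      Metric.closedBall (u 0) (max (length n u) ‖u k - u 0‖)) :=
    isCompact_univ_pi fun k => isCompact_closedBall _ _
  refine hball.of_isClosed_subset ?_ fun m hm k _ => ?_
  · have h0 : IsClosed {m : ℕ → ℂ | m 0 = u 0} := isClosed_eq (continuous_apply 0) continuous_const
    have htail : IsClosed {m : ℕ → ℂ | ∀ k ≥ n, m k = u k} := by
      simp only [Set.ofPred_forall]
      exact isClosed_iInter fun k => isClosed_iInter fun _ =>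
        isClosed_eq (continuous_apply k) continuous_const
    exact h0.inter (htail.inter ((isClosed_le continuous_const (continuous_area n)).inter
      (isClosed_le (continuous_length n) continuous_const)))
  · rw [mem_closedBall_iff_norm]
    rcases le_total k n with hk | hk
    · rw [← hm.1]
      exact le_max_of_le_left ((norm_sub_le_length hk m).trans hm.2.2.2)
    · rw [hm.2.1 k hk]
      exact le_max_right _ _

lemma exists_isEquilateral_mem_improvements (n : ℕ) (u : ℕ → ℂ) :
    ∃ m ∈ improvements n u, IsEquilateral n m := by
  obtain ⟨m, hm, hmin⟩ := (isCompact_improvements n u).exists_isMinOn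
    ⟨u, rfl, fun _ _ => rfl, le_rfl, le_rfl⟩ (continuous_energy n).continuousOn
  refine ⟨m, hm, fun k hk => ?_⟩
  by_contra hne
  obtain ⟨X, hwedge, hlength, henergy⟩ := exists_balanced_of_norm_ne hne
  refine (isMinOn_iff.1 hmin (Function.update m (k + 1) X) ⟨?_, fun j hj => ?_, ?_, ?_⟩).not_gt ?_
  · rw [Function.update_of_ne (k.succ_ne_zero).symm, hm.1]
  · rw [Function.update_of_ne (by omega), hm.2.1 j hj]
  · rw [area_update hk, hwedge, sub_self, zero_div, add_zero]
    exact hm.2.2.1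
  · rw [length_update hk]
    linarith [hm.2.2.2]
  · rw [energy_update hk]
    linarith

lemma IsEquilateral.norm_sub_eq (h : IsEquilateral n u) (hk : k < n) :
    ‖u (k + 1) - u k‖ = ‖u 1 - u 0‖ := by
  induction k with
  | zero => rfl
  | succ k ih => rw [← h k hk, ih (Nat.lt_of_succ_lt hk)]

lemma IsEquilateral.mul_energy (h : IsEquilateral n u) : n * energy n u = length n u ^ 2 := by
  rw [energy, length, Finset.sum_congr rfl fun k hk => h.norm_sub_eq (Finset.mem_range.1 hk),
    Finset.sum_congr rfl fun k hk => by rw [h.norm_sub_eq (Finset.mem_range.1 hk)],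
    Finset.sum_const, Finset.sum_const, Finset.card_range, nsmul_eq_mul, nsmul_eq_mul]
  ring

end Equilateral

section Isoperimetric

variable {θ : ℝ} {n : ℕ} {u : ℕ → ℂ}

theorem mul_four_mul_area_add_le (hθ : 0 < θ) (hn : n * θ < Real.pi) (hcot : 0 ≤ Real.cot θ)
    (u : ℕ → ℂ) :
    n * (4 * area n u + Real.cot (n * θ) * ‖u n - u 0‖ ^ 2) ≤ Real.cot θ * length n u ^ 2 := by
  obtain ⟨m, ⟨hm0, hmn, harea, hlength⟩, hm⟩ := exists_isEquilateral_mem_improvements n u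
  calc n * (4 * area n u + Real.cot (n * θ) * ‖u n - u 0‖ ^ 2)
      ≤ n * (4 * area n m + Real.cot (n * θ) * ‖m n - m 0‖ ^ 2) := by
        rw [hmn n le_rfl, hm0]; gcongr
    _ ≤ n * (Real.cot θ * energy n m) := by gcongr; exact four_mul_area_add_le hθ hn
    _ = Real.cot θ * length n m ^ 2 := by rw [← hm.mul_energy]; ring
    _ ≤ Real.cot θ * length n u ^ 2 := by gcongr; exact length_nonneg n m

lemma isEquilateral_of_mul_four_mul_area_add_eq (hθ : 0 < θ) (hn : n * θ < Real.pi)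
    (hcot : 0 < Real.cot θ)
    (h : n * (4 * area n u + Real.cot (n * θ) * ‖u n - u 0‖ ^ 2) =
      Real.cot θ * length n u ^ 2) : IsEquilateral n u := by
  intro k hk
  by_contra hne
  set L := length n u
  have hL : 0 ≤ L := length_nonneg n u
  have hn0 : (0 : ℝ) < n := by exact_mod_cast (by omega : 0 < n)
  set κ := min 1 (n / (Real.cot θ * (2 * L + 1)))
  have hκ : 0 < κ := by positivity
  have hκn : κ * (Real.cot θ * (2 * L + 1)) ≤ n :=
    (le_div_iff₀ (by positivity)).1 (min_le_right _ _)
  obtain ⟨X, g, hg0, hg1, hwedge, hlength⟩ := exists_wedge_gain_of_norm_ne hκ hne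
  have hle := mul_four_mul_area_add_le hθ hn hcot.le (Function.update u (k + 1) X)
  rw [area_update hk, hwedge, add_sub_cancel_left, Function.update_of_ne (by omega),
    Function.update_of_ne (by omega)] at hle
  have hlt : length n (Function.update u (k + 1) X) < L + κ * g := by
    rw [length_update hk]
    linarith
  have hlt_sq : length n (Function.update u (k + 1) X) ^ 2 < (L + κ * g) ^ 2 :=
    pow_lt_pow_left₀ hlt (length_nonneg _ _) two_ne_zero
  have hκg : (κ * g) ^ 2 ≤ κ * g :=
    pow_le_of_le_one (by positivity) (mul_le_one₀ (min_le_left _ _) hg0 hg1) two_ne_zero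
  have : n * (2 * g) < n * g := by
    calc n * (2 * g) ≤ Real.cot θ * length n (Function.update u (k + 1) X) ^ 2
          - Real.cot θ * L ^ 2 := by rw [← h]; linarith
      _ < Real.cot θ * (L + κ * g) ^ 2 - Real.cot θ * L ^ 2 := by gcongr
      _ = Real.cot θ * (2 * L * (κ * g) + (κ * g) ^ 2) := by ring
      _ ≤ Real.cot θ * (2 * L * (κ * g) + κ * g) := by gcongr
      _ = κ * (Real.cot θ * (2 * L + 1)) * g := by ring
      _ ≤ n * g := by gcongr
  linarith [mul_nonneg hn0.le hg0]

theorem isRegularArc_of_mul_four_mul_area_add_eq (hθ : 0 < θ) (hn : n * θ < Real.pi)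
    (hcot : 0 < Real.cot θ) (hn0 : n ≠ 0)
    (h : n * (4 * area n u + Real.cot (n * θ) * ‖u n - u 0‖ ^ 2) =
      Real.cot θ * length n u ^ 2) : IsRegularArc θ n u := by
  have hequi := isEquilateral_of_mul_four_mul_area_add_eq hθ hn hcot h
  refine isRegularArc_of_four_mul_area_add_eq hθ hn
    (mul_left_cancel₀ (Nat.cast_ne_zero.2 hn0) (h.trans ?_))
  rw [← hequi.mul_energy]
  ring

end Isoperimetric

section RegularArc

variable {θ : ℝ} {n : ℕ} {u : ℕ → ℂ}

lemma norm_circleExp_mul_sub (θ : ℝ) (v : ℂ) (a b : ℕ) :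
    ‖Circle.exp (2 * (a * θ)) * v - Circle.exp (2 * (b * θ)) * v‖ =
      2 * |Real.sin (a * θ - b * θ)| * ‖v‖ := by
  rw [← sub_mul, norm_mul, norm_circleExp_sub]

lemma IsRegularArc.norm_sub_mul_sin (h : IsRegularArc θ n u) (hθ : 0 < θ) (hn : n * θ < Real.pi)
    {a b : ℕ} (ha : a ≤ n) (hb : b ≤ n) :
    ‖u a - u b‖ * Real.sin (n * θ) = |Real.sin (a * θ - b * θ)| * ‖u n - u 0‖ := by
  obtain ⟨c, v, hv⟩ := h
  have hsin : 0 ≤ Real.sin (n * θ) := Real.sin_nonneg_of_nonneg_of_le_pi (by positivity) hn.le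
  rw [hv a ha, hv b hb, hv n le_rfl, hv 0 n.zero_le, add_sub_add_left_eq_sub,
    add_sub_add_left_eq_sub, norm_circleExp_mul_sub, norm_circleExp_mul_sub, Nat.cast_zero,
    zero_mul, sub_zero, abs_of_nonneg hsin]
  ring

lemma IsRegularArc.isEquilateral (h : IsRegularArc θ n u) : IsEquilateral n u := by
  obtain ⟨c, v, hv⟩ := h
  intro k hk
  rw [hv k (by omega), hv (k + 1) hk.le, hv (k + 2) hk, add_sub_add_left_eq_sub,
    add_sub_add_left_eq_sub, norm_circleExp_mul_sub, norm_circleExp_mul_sub, ← sub_mul, ← sub_mul]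
  push_cast
  ring_nf

lemma IsRegularArc.defect_eq_zero (h : IsRegularArc θ n u) {k : ℕ} (hk : k < n) :
    defect θ u k = 0 := by
  obtain ⟨c, v, hv⟩ := h
  have hsucc : ((k + 1 : ℕ) : ℝ) * θ = k * θ + θ := by push_cast; ring
  have hchord (j : ℕ) (hj : j ≤ n) :
      u j - u 0 = 2 * Complex.I * Real.sin (j * θ) * Circle.exp (j * θ) * v := by
    rw [← circleExp_two_mul_sub_one, hv j hj, hv 0 n.zero_le, Nat.cast_zero, zero_mul, mul_zero,
      Circle.exp_zero, Circle.coe_one]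
    ring
  rw [defect, hchord k hk.le, hchord (k + 1) hk, hsucc, Circle.exp_add, Circle.coe_mul,
    show (_ - _ : ℂ) = 0 by ring, norm_zero]
  simp

theorem IsRegularArc.four_mul_area_add_eq (h : IsRegularArc θ n u) (hθ : 0 < θ)
    (hn : n * θ < Real.pi) :
    4 * area n u + Real.cot (n * θ) * ‖u n - u 0‖ ^ 2 = Real.cot θ * energy n u := by
  rw [cot_mul_energy_eq hθ hn, Finset.sum_eq_zero fun k hk => h.defect_eq_zero
    (Finset.mem_range.1 hk), add_zero]

theorem IsRegularArc.mul_four_mul_area_add_eq (h : IsRegularArc θ n u) (hθ : 0 < θ)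
    (hn : n * θ < Real.pi) :
    n * (4 * area n u + Real.cot (n * θ) * ‖u n - u 0‖ ^ 2) = Real.cot θ * length n u ^ 2 := by
  rw [h.four_mul_area_add_eq hθ hn, ← h.isEquilateral.mul_energy]
  ring

lemma IsRegularArc.area_mul_sin_sq (h : IsRegularArc θ n u) (hθ : 0 < θ) (hn : n * θ < Real.pi)
    (hn0 : 0 < n) :
    4 * Real.sin (n * θ) ^ 2 * area n u = (n * (Real.sin θ * Real.cos θ) -
      Real.sin (n * θ) * Real.cos (n * θ)) * ‖u n - u 0‖ ^ 2 := by
  have hsin : Real.sin (n * θ) ≠ 0 := (sin_natCast_mul_pos hθ hn hn0 le_rfl).ne'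
  have hsinθ : Real.sin θ ≠ 0 := by
    simpa using (sin_natCast_mul_pos (k := 1) hθ hn one_pos hn0).ne'
  have henergy : Real.sin (n * θ) ^ 2 * energy n u =
      n * Real.sin θ ^ 2 * ‖u n - u 0‖ ^ 2 := by
    have hedge (k : ℕ) (hk : k < n) : Real.sin (n * θ) ^ 2 * ‖u (k + 1) - u k‖ ^ 2 =
        Real.sin θ ^ 2 * ‖u n - u 0‖ ^ 2 := by
      have := h.norm_sub_mul_sin hθ hn (a := k + 1) (b := k) hk hk.le
      rw [Nat.cast_add_one, add_one_mul, add_sub_cancel_left] at this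
      rw [← mul_pow, mul_comm, this, mul_pow, sq_abs]
    rw [energy, Finset.mul_sum, Finset.sum_congr rfl fun k hk => hedge k (Finset.mem_range.1 hk),
      Finset.sum_const, Finset.card_range, nsmul_eq_mul, mul_assoc]
  have h := h.four_mul_area_add_eq hθ hn
  rw [Real.cot_eq_cos_div_sin, Real.cot_eq_cos_div_sin] at h
  field_simp at h
  refine mul_left_cancel₀ hsinθ ?_
  linear_combination Real.sin (n * θ) * h + Real.cos θ * henergy

/-- The regular arc on the circle of radius `r` about the origin which starts on the real axis. -/
def regularArc (θ r : ℝ) (k : ℕ) : ℂ := Circle.exp (2 * (k * θ)) * r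

lemma isRegularArc_regularArc (θ r : ℝ) (n : ℕ) : IsRegularArc θ n (regularArc θ r) :=
  ⟨0, r, fun _ _ => (zero_add _).symm⟩

-- By `IsRegularArc.area_mul_sin_sq`, the equation says that the arc with four edges and chord `e`
-- has area one. Dividing it by `8 sin² θ cos θ` leaves `G θ = 0`, with `G` continuous.
lemma exists_angle_of_chord {e : ℝ} (he : 0 < e) :
    ∃ θ ∈ Set.Ioo 0 (Real.pi / 4),
      e ^ 2 * (4 * (Real.sin θ * Real.cos θ) - Real.sin (4 * θ) * Real.cos (4 * θ)) =
        4 * Real.sin (4 * θ) ^ 2 := by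
  let G (θ : ℝ) : ℝ := e ^ 2 * Real.sin θ * (2 * Real.cos (2 * θ) ^ 2 + 2 * Real.cos (2 * θ) + 1) -
    8 * Real.cos (2 * θ) ^ 2 * Real.cos θ
  have h0 : G 0 < 0 := by simp [G]
  have h1 : 0 < G (Real.pi / 4) := by
    have : 2 * (Real.pi / 4) = Real.pi / 2 := by ring
    simp [G, this, he]
  obtain ⟨θ, hθ, hG⟩ := intermediate_value_Ioo (by positivity) (f := G)
    (by fun_prop : Continuous G).continuousOn ⟨h0, h1⟩
  refine ⟨θ, hθ, ?_⟩
  have hc : 1 - Real.cos (2 * θ) = 2 * Real.sin θ ^ 2 := by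
    rw [Real.cos_two_mul, Real.cos_sq']
    ring
  have h4 : 4 * θ = 2 * (2 * θ) := by ring
  rw [h4, Real.sin_two_mul (2 * θ), Real.cos_two_mul (2 * θ), Real.sin_two_mul θ]
  simp only [G] at hG
  linear_combination 8 * Real.sin θ ^ 2 * Real.cos θ * hG +
    4 * e ^ 2 * Real.sin θ * Real.cos θ *
      (2 * Real.cos (2 * θ) ^ 2 + 2 * Real.cos (2 * θ) + 1) * hc

end RegularArc

section Inscribed

variable {n : ℕ} {u : ℕ → ℂ} {c v ω : ℂ} {r : ℝ}

lemma mul_eq_one_of_norm_sub_one_eq {z w : ℂ} (hz : ‖z‖ = 1) (hw : ‖w‖ = 1) (hzw : z ≠ w)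
    (h : ‖z - 1‖ = ‖w - 1‖) : z * w = 1 := by
  rw [← sq_eq_sq₀ (norm_nonneg _) (norm_nonneg _)] at h
  have hz' : ‖z‖ ^ 2 = 1 := by rw [hz, one_pow]
  have hw' : ‖w‖ ^ 2 = 1 := by rw [hw, one_pow]
  simp only [Complex.sq_norm, Complex.normSq_apply, Complex.sub_re, Complex.sub_im, Complex.one_re,
    Complex.one_im] at h hz' hw'
  have hre : z.re = w.re := by linarith
  have him : z.im = -w.im := by
    refine (sq_eq_sq_iff_eq_or_eq_neg.1 (by rw [hre] at hz'; linarith)).resolve_left fun him => ?_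
    exact hzw (Complex.ext hre him)
  apply Complex.ext
  · rw [Complex.mul_re, hre, him, Complex.one_re]
    linarith
  · rw [Complex.mul_im, hre, him, Complex.one_im]
    ring

lemma exists_rotation (hu : ∀ k ≤ n, ‖u k - c‖ = r) (hr : 0 < r) (hequi : IsEquilateral n u)
    (hne : ∀ k, k + 2 ≤ n → u k ≠ u (k + 2)) (hn : 0 < n) :
    ∃ ω : ℂ, ‖ω‖ = 1 ∧ ∀ k ≤ n, u k = c + ω ^ k * (u 0 - c) := by
  have h0 {k : ℕ} (hk : k ≤ n) : u k - c ≠ 0 := norm_pos_iff.1 (by rw [hu k hk]; exact hr)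
  have hnorm {j k : ℕ} (hj : j ≤ n) (hk : k ≤ n) : ‖(u j - c) / (u k - c)‖ = 1 := by
    rw [norm_div, hu j hj, hu k hk, div_self hr.ne']
  have hratio (k : ℕ) (hk : k + 1 < n) :
      (u (k + 2) - c) / (u (k + 1) - c) = (u (k + 1) - c) / (u k - c) := by
    have hprod : (u k - c) / (u (k + 1) - c) * ((u (k + 2) - c) / (u (k + 1) - c)) = 1 := by
      refine mul_eq_one_of_norm_sub_one_eq (hnorm (by omega) (by omega)) (hnorm hk (by omega))
        (fun h => hne k hk ?_) ?_
      · rwa [div_left_inj' (h0 hk.le), sub_left_inj] at h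
      · rw [div_sub_one (h0 hk.le), div_sub_one (h0 hk.le), norm_div, norm_div,
          sub_sub_sub_cancel_right, sub_sub_sub_cancel_right, norm_sub_rev (u k), hequi k hk]
    rw [← inv_div (u k - c)]
    exact eq_inv_of_mul_eq_one_right hprod
  have hstep (k : ℕ) (hk : k < n) : (u (k + 1) - c) / (u k - c) = (u 1 - c) / (u 0 - c) := by
    induction k with
    | zero => rfl
    | succ k ih => rw [hratio k hk, ih (by omega)]
  refine ⟨(u 1 - c) / (u 0 - c), hnorm hn hn.le, fun k hk => ?_⟩
  induction k with
  | zero => simp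
  | succ k ih =>
    rw [pow_succ', mul_assoc, ← sub_eq_iff_eq_add'.2 (ih (by omega)), ← hstep k hk,
      div_mul_cancel₀ _ (h0 (by omega)), add_sub_cancel]

lemma exists_chords_meet (hω : ‖ω‖ = 1) (hre : ω.re ≤ 0) :
    ∃ s ∈ Set.Icc (0 : ℝ) 1, (1 - s) + s * ω = (1 - s) * ω ^ 4 + s * ω ^ 3 := by
  have hunit : 1 + ω ^ 2 = 2 * ω.re * ω := by
    have hone : ω * (starRingEnd ℂ) ω = 1 := by rw [Complex.mul_conj', hω]; simp
    have hadd : ω + (starRingEnd ℂ) ω = 2 * ω.re := mod_cast Complex.add_conj ω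
    linear_combination ω * hadd - hone
  have hpos : 0 < 1 - 2 * ω.re := by linarith
  refine ⟨-(2 * ω.re) / (1 - 2 * ω.re), ⟨div_nonneg (by linarith) hpos.le,
    (div_le_one hpos).2 (by linarith)⟩, ?_⟩
  have hs : (1 + 2 * ω.re / (1 - 2 * ω.re)) * (2 * ω.re) - 2 * ω.re / (1 - 2 * ω.re) = 0 := by
    field_simp
    ring
  have hs' : ((1 + 2 * ω.re / (1 - 2 * ω.re)) * (2 * ω.re) - 2 * ω.re / (1 - 2 * ω.re) : ℂ) = 0 :=
    mod_cast hs
  push_cast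
  linear_combination (1 - ω ^ 2) * (1 + 2 * ω.re / (1 - 2 * ω.re)) * hunit + (1 - ω ^ 2) * ω * hs'

lemma re_pos_of_disjoint (hω : ‖ω‖ = 1) (hu : ∀ k ≤ 4, u k = c + ω ^ k * v)
    (hdisj : Disjoint (affineSegment ℝ (u 0) (u 1)) (affineSegment ℝ (u 4) (u 3))) : 0 < ω.re := by
  by_contra! hre
  obtain ⟨s, hs, hmeet⟩ := exists_chords_meet hω hre
  refine Set.disjoint_left.1 hdisj ⟨s, hs, rfl⟩ ⟨s, hs, ?_⟩
  rw [AffineMap.lineMap_apply_module, AffineMap.lineMap_apply_module, hu 0 (by norm_num),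
    hu 1 (by norm_num), hu 3 (by norm_num), hu 4 le_rfl]
  simp only [Complex.real_smul]
  push_cast
  linear_combination -v * hmeet

lemma exists_isRegularArc_of_rotation (hω : ‖ω‖ = 1) (hre : 0 < ω.re) (him : 0 < ω.im)
    (hu : ∀ k ≤ n, u k = c + ω ^ k * v) : ∃ θ ∈ Set.Ioo 0 (Real.pi / 4), IsRegularArc θ n u := by
  have harg_pos : 0 < ω.arg :=
    (Complex.arg_nonneg_iff.2 him.le).lt_of_ne' fun h => him.ne' (Complex.arg_eq_zero_iff.1 h).2
  have harg_lt : ω.arg < Real.pi / 2 :=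
    (le_abs_self _).trans_lt (Complex.abs_arg_lt_pi_div_two_iff.2 (Or.inl hre))
  have hexp : Complex.exp (ω.arg * Complex.I) = ω := by
    simpa [hω] using Complex.norm_mul_exp_arg_mul_I ω
  refine ⟨ω.arg / 2, ⟨by linarith, by linarith⟩, c, v, fun k hk => ?_⟩
  have hangle : 2 * (k * (ω.arg / 2)) = k * ω.arg := by ring
  rw [hu k hk, hangle, Circle.coe_exp, Complex.ofReal_mul, Complex.ofReal_natCast, mul_assoc,
    Complex.exp_nat_mul, hexp]

theorem exists_isRegularArc_of_disjoint (hu : ∀ k ≤ 4, ‖u k - c‖ = r) (hequi : IsEquilateral 4 u)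
    (hne : ∀ k, k + 2 ≤ 4 → u k ≠ u (k + 2))
    (hdisj : Disjoint (affineSegment ℝ (u 0) (u 1)) (affineSegment ℝ (u 4) (u 3))) :
    ∃ θ ∈ Set.Ioo 0 (Real.pi / 4), IsRegularArc θ 4 u ∨ IsRegularArc θ 4 (star u) := by
  have hr : 0 < r := by
    refine ((norm_nonneg _).trans_eq (hu 0 (by norm_num))).lt_of_ne ?_
    rintro rfl
    refine hne 0 (by norm_num) ?_
    rw [← sub_left_inj (a := c), norm_eq_zero.1 (hu 0 (by norm_num)),
      norm_eq_zero.1 (hu 2 (by norm_num))]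
  obtain ⟨ω, hω, hrot⟩ := exists_rotation hu hr hequi hne (by norm_num)
  have hre := re_pos_of_disjoint hω hrot hdisj
  have him : ω.im ≠ 0 := fun him => by
    have hone : ω ^ 2 = 1 := by
      rw [sq]
      nth_rw 2 [← Complex.conj_eq_iff_im.2 him]
      rw [Complex.mul_conj', hω]
      simp
    refine hne 0 (by norm_num) ?_
    rw [hrot 2 (by norm_num), hone, one_mul, add_sub_cancel]
  rcases him.lt_or_gt with him | him
  · have hstar : ∀ k ≤ 4, star u k = star c + star ω ^ k * star (u 0 - c) := fun k hk => by
      rw [Pi.star_apply, hrot k hk, star_add, star_mul', star_pow]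
    obtain ⟨θ, hθ, h⟩ := exists_isRegularArc_of_rotation (ω := star ω) (by rwa [norm_star])
      (by simpa using hre) (by simpa using him) hstar
    exact ⟨θ, hθ, Or.inr h⟩
  · obtain ⟨θ, hθ, h⟩ := exists_isRegularArc_of_rotation hω hre him hrot
    exact ⟨θ, hθ, Or.inl h⟩

end Inscribed

end PlanarPath

namespace Plane

/-- The plane as the complex numbers. -/
def toComplex : Plane ≃ₗᵢ[ℝ] ℂ := Complex.orthonormalBasisOneI.repr.symm

lemma re_toComplex (x : Plane) : (toComplex x).re = x 0 := by
  simp [toComplex, Complex.orthonormalBasisOneI_repr_symm_apply]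

lemma im_toComplex (x : Plane) : (toComplex x).im = x 1 := by
  simp [toComplex, Complex.orthonormalBasisOneI_repr_symm_apply]

lemma norm_toComplex_sub (x y : Plane) : ‖toComplex x - toComplex y‖ = dist x y := by
  rw [← map_sub, LinearIsometryEquiv.norm_map, dist_eq_norm]

/-! ### Polygons in the plane -/

section PolygonPath

variable {n : ℕ} (p : Polygon Plane (n + 1)) (i : Fin (n + 1))

/-- The vertices of a polygon as a path of period `n + 1`, beginning at the end of the `i`-th edge;
its first `n` edges are the edges of the polygon other than the `i`-th. -/
def path (k : ℕ) : ℂ := toComplex (p (i + 1 + Fin.ofNat (n + 1) k))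

lemma path_zero : path p i 0 = toComplex (p (i + 1)) := by
  rw [path, Fin.ofNat_zero, add_zero]

lemma path_succ (k : ℕ) :
    path p i (k + 1) = toComplex (p (finRotate _ (i + 1 + Fin.ofNat (n + 1) k))) := by
  rw [path, finRotate_apply, add_assoc _ _ 1]
  congr 3
  exact Fin.ext (by simp [Fin.add_def])

lemma add_one_add_ofNat_self : i + 1 + Fin.ofNat (n + 1) n = i := by
  rw [add_assoc]
  exact add_eq_left.2 (Fin.ext (by simp [Fin.add_def, add_comm]))

lemma add_one_add_ofNat_ne {k : ℕ} (hk : k < n) : i + 1 + Fin.ofNat (n + 1) k ≠ i := by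
  intro h
  have hval := Fin.ext_iff.1 (add_left_cancel (h.trans (add_one_add_ofNat_self i).symm))
  rw [Fin.val_ofNat, Fin.val_ofNat, Nat.mod_eq_of_lt (by omega), Nat.mod_eq_of_lt (by omega)]
    at hval
  exact hk.ne hval

lemma exists_eq_add_one_add_ofNat {i j : Fin (n + 1)} (hj : j ≠ i) :
    ∃ k < n, j = i + 1 + Fin.ofNat (n + 1) k := by
  have hval : j = i + 1 + Fin.ofNat (n + 1) (j - (i + 1)).val := by
    rw [Fin.ofNat_val_eq_self, add_sub_cancel]
  refine ⟨(j - (i + 1)).val, lt_of_le_of_ne (by omega) fun h => hj ?_, hval⟩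
  rw [hval, h, add_one_add_ofNat_self]

lemma path_last : path p i n = toComplex (p i) := by
  rw [path, add_one_add_ofNat_self]

lemma norm_path_succ_sub (k : ℕ) :
    ‖path p i (k + 1) - path p i k‖ = p.edgeLength (i + 1 + Fin.ofNat (n + 1) k) := by
  rw [path_succ, norm_sub_rev, path, norm_toComplex_sub, Polygon.edgeLength]

lemma norm_path_sub : ‖path p i n - path p i 0‖ = p.edgeLength i := by
  rw [path_last, path_zero, norm_toComplex_sub, Polygon.edgeLength, finRotate_apply]

lemma sum_path (f : ℂ → ℂ → ℝ) :
    ∑ k ∈ Finset.range (n + 1), f (path p i k) (path p i (k + 1)) =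
      ∑ j, f (toComplex (p j)) (toComplex (p (finRotate _ j))) := by
  rw [← Fin.sum_univ_eq_sum_range (fun k => f (path p i k) (path p i (k + 1))),
    ← Equiv.sum_comp (Equiv.addLeft (i + 1))
      fun j => f (toComplex (p j)) (toComplex (p (finRotate _ j)))]
  simp only [path_succ]
  simp only [path, Fin.ofNat_val_eq_self, Equiv.coe_addLeft]

lemma length_path : PlanarPath.length n (path p i) = p.perimeter - p.edgeLength i := by
  have hsum := sum_path p i fun z w => ‖w - z‖
  rw [Finset.sum_range_succ, norm_path_succ_sub, add_one_add_ofNat_self] at hsum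
  rw [eq_sub_iff_add_eq, PlanarPath.length, hsum, Polygon.perimeter]
  simp only [Polygon.edgeLength, norm_toComplex_sub, dist_comm]

lemma area_path : PlanarPath.area n (path p i) = shoelace p := by
  set o := path p i 0
  have hlast : path p i (n + 1) = o := by
    rw [path_succ, add_one_add_ofNat_self, finRotate_apply, ← path_zero]
  have hsum := sum_path p i fun z w => PlanarPath.wedge (z - o) (w - o) / 2
  have htele := Equiv.sum_comp (finRotate (n + 1)) fun j => PlanarPath.wedge o (toComplex (p j)) / 2
  rw [Finset.sum_range_succ, hlast, sub_self,
    show PlanarPath.wedge (path p i n - o) 0 = 0 by simp [PlanarPath.wedge],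
    zero_div, add_zero] at hsum
  rw [PlanarPath.area, hsum, ← sub_eq_zero, shoelace, ← Finset.sum_sub_distrib]
  rw [← sub_eq_zero, ← Finset.sum_sub_distrib] at htele
  rw [← neg_eq_zero, ← htele, ← Finset.sum_neg_distrib]
  refine Finset.sum_congr rfl fun j _ => ?_
  simp only [PlanarPath.wedge, Complex.sub_re, Complex.sub_im, re_toComplex, im_toComplex]
  ring

lemma isEquilateral_path_iff : PlanarPath.IsEquilateral n (path p i) ↔
    ∀ j k, j ≠ i → k ≠ i → p.edgeLength j = p.edgeLength k := by
  refine ⟨fun h j k hj hk => ?_, fun h k hk => ?_⟩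
  · obtain ⟨j, hjn, rfl⟩ := exists_eq_add_one_add_ofNat hj
    obtain ⟨k, hkn, rfl⟩ := exists_eq_add_one_add_ofNat hk
    rw [← norm_path_succ_sub, ← norm_path_succ_sub, h.norm_sub_eq hjn, h.norm_sub_eq hkn]
  · rw [norm_path_succ_sub, norm_path_succ_sub]
    exact h _ _ (add_one_add_ofNat_ne i (by omega)) (add_one_add_ofNat_ne i hk)

end PolygonPath

section Convex

variable {n : ℕ} {p : Polygon Plane n}

lemma eq_or_eq_of_cross_nonpos
    (h : ∀ i j, j ≠ i → j ≠ finRotate n i → 0 < cross (p i) (p (finRotate n i)) (p j))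
    {i j : Fin n} (hij : cross (p i) (p (finRotate n i)) (p j) ≤ 0) :
    j = i ∨ j = finRotate n i := by
  by_contra! hj
  exact (h i j hj.1 hj.2).not_ge hij

lemma vertices_injective_of_cross_pos (hn : 3 ≤ n)
    (h : ∀ i j, j ≠ i → j ≠ finRotate n i → 0 < cross (p i) (p (finRotate n i)) (p j)) :
    Function.Injective p.vertices := by
  intro i j hij
  have hj : cross (p i) (p (finRotate n i)) (p j) = 0 := by rw [← hij, cross_left]
  refine ((eq_or_eq_of_cross_nonpos h hj.le).resolve_right fun hrot => ?_).symm
  have hne := h i _ (finRotate_finRotate_ne_self hn i) (finRotate_ne_self hn _)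
  rw [← hrot, ← hij] at hne
  simp [cross] at hne

lemma edgeSet_inter_subset_of_cross_pos (hn : 3 ≤ n)
    (h : ∀ i j, j ≠ i → j ≠ finRotate n i → 0 < cross (p i) (p (finRotate n i)) (p j))
    {i j : Fin n} (hij : i ≠ j) :
    p.edgeSet ℝ i ∩ p.edgeSet ℝ j ⊆ {p i, p (finRotate n i)} := by
  have hnonneg (k : Fin n) : 0 ≤ cross (p i) (p (finRotate n i)) (p k) := by
    by_contra! hk
    rcases eq_or_eq_of_cross_nonpos h hk.le with rfl | rfl
    · exact hk.ne (cross_left _ _)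
    · exact hk.ne (cross_right _ _)
  have hvertex {k : Fin n} (hk : cross (p i) (p (finRotate n i)) (p k) = 0) :
      p k ∈ ({p i, p (finRotate n i)} : Set Plane) :=
    (eq_or_eq_of_cross_nonpos h hk.le).imp (congrArg p) (congrArg p)
  rintro _ ⟨hx, s, hs, rfl⟩
  have hsum := cross_eq_zero_of_mem hx
  rw [cross_lineMap, add_eq_zero_iff_of_nonneg (mul_nonneg (sub_nonneg.2 hs.2) (hnonneg j))
    (mul_nonneg hs.1 (hnonneg _)), mul_eq_zero, mul_eq_zero, sub_eq_zero] at hsum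
  rcases hsum with ⟨rfl | hj, hs₀ | hj'⟩
  · exact absurd hs₀ one_ne_zero
  · simpa using hvertex hj'
  · simpa [hs₀] using hvertex hj
  · rcases eq_or_eq_of_cross_nonpos h hj.le with rfl | rfl
    · exact absurd rfl hij
    · rcases eq_or_eq_of_cross_nonpos h hj'.le with hrot | hrot
      · exact absurd hrot (finRotate_finRotate_ne_self hn i)
      · exact absurd hrot (finRotate_ne_self hn _)

theorem isSimple_of_cross_pos (hn : 3 ≤ n)
    (h : ∀ i j, j ≠ i → j ≠ finRotate n i → 0 < cross (p i) (p (finRotate n i)) (p j)) :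
    p.IsSimple :=
  ⟨vertices_injective_of_cross_pos hn h, fun _ _ hij => Set.subset_inter
    (edgeSet_inter_subset_of_cross_pos hn h hij)
    (Set.inter_comm _ _ ▸ edgeSet_inter_subset_of_cross_pos hn h hij.symm)⟩

end Convex

section ArcPolygon

variable {n : ℕ} {θ r : ℝ}

/-- The polygon whose vertices are those of a regular arc with `n` edges, so that its last edge is
the chord of the arc. -/
def arcPolygon (n : ℕ) (θ r : ℝ) : Polygon Plane (n + 1) :=
  ⟨fun k => toComplex.symm (PlanarPath.regularArc θ r k)⟩

lemma arcPolygon_apply (k : Fin (n + 1)) :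
    arcPolygon n θ r k = toComplex.symm (PlanarPath.regularArc θ r k) := rfl

lemma cross_arcPolygon (a b c : Fin (n + 1)) :
    cross (arcPolygon n θ r a) (arcPolygon n θ r b) (arcPolygon n θ r c) =
      4 * r ^ 2 * (Real.sin (b * θ - a * θ) * Real.sin (c * θ - b * θ) *
        Real.sin (c * θ - a * θ)) := by
  have hcoord (k : Fin (n + 1)) : arcPolygon n θ r k 0 = Real.cos (2 * (k * θ)) * r ∧
      arcPolygon n θ r k 1 = Real.sin (2 * (k * θ)) * r := by
    rw [← re_toComplex, ← im_toComplex, arcPolygon_apply, LinearIsometryEquiv.apply_symm_apply,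
      PlanarPath.regularArc, Complex.re_mul_ofReal, Complex.im_mul_ofReal,
      PlanarPath.re_circleExp, PlanarPath.im_circleExp]
    exact ⟨rfl, rfl⟩
  have hcos (α β : ℝ) : Real.cos (2 * α) - Real.cos (2 * β) =
      -2 * Real.sin (α + β) * Real.sin (α - β) := by
    rw [Real.cos_sub_cos]; ring_nf
  have hsin (α β : ℝ) : Real.sin (2 * α) - Real.sin (2 * β) =
      2 * Real.sin (α - β) * Real.cos (α + β) := by
    rw [Real.sin_sub_sin]; ring_nf
  have hsub : Real.sin (c * θ - b * θ) =
      Real.sin (c * θ + a * θ) * Real.cos (b * θ + a * θ) -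
        Real.cos (c * θ + a * θ) * Real.sin (b * θ + a * θ) := by
    rw [← Real.sin_sub, add_sub_add_right_eq_sub]
  rw [cross, (hcoord a).1, (hcoord b).1, (hcoord c).1, (hcoord a).2, (hcoord b).2, (hcoord c).2]
  simp only [← sub_mul _ _ r, hcos, hsin]
  rw [hsub]
  ring

lemma cross_arcPolygon_pos (hθ : 0 < θ) (hn : n * θ < Real.pi) (hr : r ≠ 0)
    {a b c : Fin (n + 1)} (hab : a < b) (hbc : b < c) :
    0 < cross (arcPolygon n θ r a) (arcPolygon n θ r b) (arcPolygon n θ r c) := by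
  have hsin {j k : Fin (n + 1)} (hjk : j < k) : 0 < Real.sin (k * θ - j * θ) := by
    have hle : ((k - j : ℕ) : ℝ) = (k : ℕ) - (j : ℕ) := Nat.cast_sub (Fin.le_def.1 hjk.le)
    rw [← sub_mul, ← hle]
    exact PlanarPath.sin_natCast_mul_pos hθ hn (by omega) (by omega)
  rw [cross_arcPolygon]
  have := hsin hab
  have := hsin hbc
  have := hsin (hab.trans hbc)
  positivity

lemma isSimple_arcPolygon (hθ : 0 < θ) (hn : n * θ < Real.pi) (hr : r ≠ 0) (hn2 : 2 ≤ n) :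
    (arcPolygon n θ r).IsSimple := by
  refine isSimple_of_cross_pos (by omega) fun i j hji hj => ?_
  induction i using Fin.lastCases with
  | last =>
    rw [finRotate_last] at hj ⊢
    rw [← cross_rotate]
    exact cross_arcPolygon_pos hθ hn hr (Fin.pos_iff_ne_zero.2 hj) (Fin.lt_last_iff_ne_last.2 hji)
  | cast i =>
    have hrot : finRotate (n + 1) i.castSucc = i.succ := by
      rw [finRotate_apply, Fin.coeSucc_eq_succ]
    rw [hrot] at hj ⊢
    rcases lt_or_gt_of_ne hji with hlt | hgt
    · rw [cross_rotate]
      exact cross_arcPolygon_pos hθ hn hr hlt i.castSucc_lt_succ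
    · exact cross_arcPolygon_pos hθ hn hr i.castSucc_lt_succ
        (lt_of_le_of_ne (Fin.castSucc_lt_iff_succ_le.1 hgt) hj.symm)

lemma path_arcPolygon {k : ℕ} (hk : k ≤ n) :
    path (arcPolygon n θ r) (Fin.last n) k = PlanarPath.regularArc θ r k := by
  rw [path, arcPolygon_apply, LinearIsometryEquiv.apply_symm_apply, Fin.last_add_one, zero_add,
    Fin.val_ofNat, Nat.mod_eq_of_lt (by omega)]

end ArcPolygon

end Plane

namespace PlanarPath

section Star

variable {n : ℕ} {u : ℕ → ℂ}

lemma norm_star_sub_star (z w : ℂ) : ‖star z - star w‖ = ‖z - w‖ := by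
  rw [← star_sub, norm_star]

lemma length_star (n : ℕ) (u : ℕ → ℂ) : length n (star u) = length n u := by
  simp only [length, Pi.star_apply, norm_star_sub_star]

lemma area_star (n : ℕ) (u : ℕ → ℂ) : area n (star u) = -area n u := by
  rw [area, area, ← Finset.sum_neg_distrib]
  refine Finset.sum_congr rfl fun k _ => ?_
  simp only [wedge, Pi.star_apply, Complex.star_def, Complex.sub_re, Complex.sub_im,
    Complex.conj_re, Complex.conj_im]
  ring

lemma isEquilateral_star : IsEquilateral n (star u) ↔ IsEquilateral n u := by
  simp only [IsEquilateral, Pi.star_apply, norm_star_sub_star]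

end Star

end PlanarPath

namespace Plane

section Regular

variable {n : ℕ} {p q : Polygon Plane (n + 1)} {i j : Fin (n + 1)} {θ : ℝ}

/-- The edges of the polygon other than the `i`-th form a regular arc, in one orientation of the
plane or the other. -/
def IsRegularOffEdge (θ : ℝ) (p : Polygon Plane (n + 1)) (i : Fin (n + 1)) : Prop :=
  PlanarPath.IsRegularArc θ n (path p i) ∨ PlanarPath.IsRegularArc θ n (star (path p i))

lemma edgeLength_le_perimeter_sub (p : Polygon Plane (n + 1)) (i : Fin (n + 1)) :
    p.edgeLength i ≤ p.perimeter - p.edgeLength i := by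
  rw [← length_path, ← norm_path_sub]
  exact PlanarPath.norm_sub_le_length le_rfl _

lemma norm_star_path_sub (p : Polygon Plane (n + 1)) (i : Fin (n + 1)) :
    ‖star (path p i) n - star (path p i) 0‖ = p.edgeLength i := by
  rw [Pi.star_apply, Pi.star_apply, PlanarPath.norm_star_sub_star, norm_path_sub]

theorem mul_four_mul_abs_shoelace_add_le (hθ : 0 < θ) (hn : n * θ < Real.pi)
    (hcot : 0 ≤ Real.cot θ) (p : Polygon Plane (n + 1)) (i : Fin (n + 1)) :
    n * (4 * |shoelace p| + Real.cot (n * θ) * p.edgeLength i ^ 2) ≤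
      Real.cot θ * (p.perimeter - p.edgeLength i) ^ 2 := by
  rcases abs_choice (shoelace p) with h | h
  · rw [h, ← area_path p i, ← length_path, ← norm_path_sub]
    exact PlanarPath.mul_four_mul_area_add_le hθ hn hcot _
  · rw [h, ← area_path p i, ← PlanarPath.area_star, ← length_path, ← PlanarPath.length_star,
      ← norm_star_path_sub]
    exact PlanarPath.mul_four_mul_area_add_le hθ hn hcot _

theorem isRegularOffEdge_of_mul_four_mul_abs_shoelace_add_eq (hθ : 0 < θ)
    (hn : n * θ < Real.pi) (hcot : 0 < Real.cot θ) (hn0 : n ≠ 0)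
    (h : n * (4 * |shoelace p| + Real.cot (n * θ) * p.edgeLength i ^ 2) =
      Real.cot θ * (p.perimeter - p.edgeLength i) ^ 2) : IsRegularOffEdge θ p i := by
  rcases abs_choice (shoelace p) with habs | habs
  · rw [habs, ← area_path p i, ← length_path, ← norm_path_sub] at h
    exact Or.inl (PlanarPath.isRegularArc_of_mul_four_mul_area_add_eq hθ hn hcot hn0 h)
  · rw [habs, ← area_path p i, ← PlanarPath.area_star, ← length_path, ← PlanarPath.length_star,
      ← norm_star_path_sub] at h
    exact Or.inr (PlanarPath.isRegularArc_of_mul_four_mul_area_add_eq hθ hn hcot hn0 h)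

theorem IsRegularOffEdge.mul_four_mul_abs_shoelace_add_eq (h : IsRegularOffEdge θ p i)
    (hθ : 0 < θ) (hn : n * θ < Real.pi) (hcot : 0 ≤ Real.cot θ) :
    n * (4 * |shoelace p| + Real.cot (n * θ) * p.edgeLength i ^ 2) =
      Real.cot θ * (p.perimeter - p.edgeLength i) ^ 2 := by
  refine le_antisymm (mul_four_mul_abs_shoelace_add_le hθ hn hcot p i) ?_
  rcases h with h | h
  · rw [← length_path, ← h.mul_four_mul_area_add_eq hθ hn, area_path, norm_path_sub]
    gcongr
    exact le_abs_self _
  · rw [← length_path, ← PlanarPath.length_star, ← h.mul_four_mul_area_add_eq hθ hn,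
      PlanarPath.area_star, area_path, norm_star_path_sub]
    gcongr
    exact neg_le_abs _

lemma IsRegularOffEdge.edgeLength_eq (h : IsRegularOffEdge θ p i) :
    ∀ j k, j ≠ i → k ≠ i → p.edgeLength j = p.edgeLength k := by
  rw [← isEquilateral_path_iff]
  exact h.elim (·.isEquilateral) fun h => PlanarPath.isEquilateral_star.1 h.isEquilateral

lemma IsRegularOffEdge.dist_mul_sin (h : IsRegularOffEdge θ p i) (hθ : 0 < θ)
    (hn : n * θ < Real.pi) (a b : Fin (n + 1)) :
    dist (p (i + 1 + a)) (p (i + 1 + b)) * Real.sin (n * θ) =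
      |Real.sin (a * θ - b * θ)| * p.edgeLength i := by
  have hnorm : dist (p (i + 1 + a)) (p (i + 1 + b)) = ‖path p i a - path p i b‖ := by
    rw [path, path, norm_toComplex_sub, Fin.ofNat_val_eq_self, Fin.ofNat_val_eq_self]
  rw [hnorm]
  rcases h with h | h
  · rw [h.norm_sub_mul_sin hθ hn a.is_le b.is_le, norm_path_sub]
  · rw [← norm_star_path_sub, ← h.norm_sub_mul_sin hθ hn a.is_le b.is_le, Pi.star_apply,
      Pi.star_apply, PlanarPath.norm_star_sub_star]

theorem IsRegularOffEdge.congruent (hp : IsRegularOffEdge θ p i) (hq : IsRegularOffEdge θ q j)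
    (hθ : 0 < θ) (hn : n * θ < Real.pi) (hn0 : 0 < n) (h : p.edgeLength i = q.edgeLength j) :
    Congruent (fun k => p (i + k)) (fun k => q (j + k)) := by
  have hindex (i k : Fin (n + 1)) : i + k = i + 1 + (k - 1) := by abel
  rw [congruent_iff_dist_eq]
  intro a b
  apply mul_right_cancel₀ (PlanarPath.sin_natCast_mul_pos hθ hn hn0 le_rfl).ne'
  rw [hindex i a, hindex i b, hindex j a, hindex j b, hp.dist_mul_sin hθ hn,
    hq.dist_mul_sin hθ hn, h]

lemma cospherical_of_norm_path_sub_eq {c : ℂ} {r : ℝ} (h : ∀ k ≤ n, ‖path p i k - c‖ = r) :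
    EuclideanGeometry.Cospherical (Set.range p.vertices) := by
  refine ⟨toComplex.symm c, r, ?_⟩
  rintro _ ⟨j, rfl⟩
  have hj := h (j - (i + 1)).val (Fin.is_le _)
  rwa [path, Fin.ofNat_val_eq_self, add_sub_cancel, ← toComplex.apply_symm_apply c,
    norm_toComplex_sub] at hj

lemma IsRegularOffEdge.cospherical (h : IsRegularOffEdge θ p i) :
    EuclideanGeometry.Cospherical (Set.range p.vertices) := by
  have hnorm {u : ℕ → ℂ} {c v : ℂ} (hu : ∀ k ≤ n, u k = c + Circle.exp (2 * (k * θ)) * v)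
      (k : ℕ) (hk : k ≤ n) : ‖u k - c‖ = ‖v‖ := by
    rw [hu k hk, add_sub_cancel_left, norm_mul, Circle.norm_coe, one_mul]
  rcases h with ⟨c, v, h⟩ | ⟨c, v, h⟩
  · exact cospherical_of_norm_path_sub_eq (hnorm h)
  · refine cospherical_of_norm_path_sub_eq (i := i) (c := star c) (r := ‖v‖) fun k hk => ?_
    rw [← PlanarPath.norm_star_sub_star, star_star]
    exact hnorm h k hk

lemma disjoint_edgeSet {n : ℕ} {p : Polygon Plane n} (hp : p.IsSimple) {i j : Fin n} (hij : i ≠ j)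
    (hi : finRotate n i ≠ j) (hj : finRotate n j ≠ i) :
    Disjoint (p.edgeSet ℝ i) (p.edgeSet ℝ j) := by
  refine Set.disjoint_left.2 fun x hxi hxj => ?_
  rcases hp.2 i j hij ⟨hxi, hxj⟩ with ⟨rfl | rfl, h | h⟩
  · exact hij (hp.1 h)
  · exact hj (hp.1 h).symm
  · exact hi (hp.1 h)
  · exact hij ((finRotate n).injective (hp.1 h))

lemma injOn_path (hp : p.IsSimple) (i : Fin (n + 1)) : Set.InjOn (path p i) (Set.Iic n) := by
  intro j hj k hk h
  have hval := Fin.ext_iff.1 (add_left_cancel (hp.1 (toComplex.injective h)))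
  rwa [Fin.val_ofNat, Fin.val_ofNat, Nat.mod_eq_of_lt (Nat.lt_succ_of_le hj),
    Nat.mod_eq_of_lt (Nat.lt_succ_of_le hk)] at hval

lemma affineSegment_path (p : Polygon Plane (n + 1)) (i : Fin (n + 1)) (k : ℕ) :
    affineSegment ℝ (path p i k) (path p i (k + 1)) =
      toComplex '' p.edgeSet ℝ (i + 1 + Fin.ofNat (n + 1) k) := by
  rw [path_succ]
  exact (affineSegment_image toComplex.toLinearEquiv.toLinearMap.toAffineMap _ _).symm

end Regular

section Pentagon

variable {p : Polygon Plane 5} {i : Fin 5}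

theorem exists_isRegularOffEdge (hp : p.IsSimple)
    (hcosph : EuclideanGeometry.Cospherical (Set.range p.vertices))
    (hequi : ∀ j k, j ≠ i → k ≠ i → p.edgeLength j = p.edgeLength k) :
    ∃ θ ∈ Set.Ioo 0 (Real.pi / 4), IsRegularOffEdge θ p i := by
  obtain ⟨c, r, hr⟩ := hcosph
  refine PlanarPath.exists_isRegularArc_of_disjoint (c := toComplex c) (r := r) (fun k _ => ?_)
    ((isEquilateral_path_iff p i).2 hequi) (fun k hk h => ?_) ?_
  · rw [path, norm_toComplex_sub]
    exact hr _ (Set.mem_range_self _)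
  · exact absurd (injOn_path hp i (Set.mem_Iic.2 (by omega)) (Set.mem_Iic.2 hk) h) (by omega)
  · rw [affineSegment_comm ℝ (path p i 4), affineSegment_path p i 0, affineSegment_path p i 3,
      Set.disjoint_image_iff toComplex.injective]
    have hindex : ∀ i : Fin 5, i + 1 + Fin.ofNat 5 0 ≠ i + 1 + Fin.ofNat 5 3 ∧
        finRotate 5 (i + 1 + Fin.ofNat 5 0) ≠ i + 1 + Fin.ofNat 5 3 ∧
        finRotate 5 (i + 1 + Fin.ofNat 5 3) ≠ i + 1 + Fin.ofNat 5 0 := by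
      decide
    exact disjoint_edgeSet hp (hindex i).1 (hindex i).2.1 (hindex i).2.2

end Pentagon

section Minimizer

variable {n : ℕ} {p q : Polygon Plane (n + 1)} {i j : Fin (n + 1)} {θ r : ℝ}

lemma isRegularArc_path_arcPolygon (n : ℕ) (θ r : ℝ) :
    PlanarPath.IsRegularArc θ n (path (arcPolygon n θ r) (Fin.last n)) := by
  obtain ⟨c, v, h⟩ := PlanarPath.isRegularArc_regularArc θ r n
  exact ⟨c, v, fun k hk => (path_arcPolygon hk).trans (h k hk)⟩

lemma edgeLength_arcPolygon_last (n : ℕ) (θ r : ℝ) :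
    (arcPolygon n θ r).edgeLength (Fin.last n) = 2 * |Real.sin (n * θ)| * |r| := by
  rw [← norm_path_sub, path_arcPolygon le_rfl, path_arcPolygon n.zero_le, PlanarPath.regularArc,
    PlanarPath.regularArc, PlanarPath.norm_circleExp_mul_sub, Nat.cast_zero, zero_mul, sub_zero,
    Complex.norm_real, Real.norm_eq_abs]

lemma shoelace_arcPolygon_mul_sin_sq (hθ : 0 < θ) (hn : n * θ < Real.pi) (hn0 : 0 < n) :
    4 * Real.sin (n * θ) ^ 2 * shoelace (arcPolygon n θ r) =
      (n * (Real.sin θ * Real.cos θ) - Real.sin (n * θ) * Real.cos (n * θ)) *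
        (arcPolygon n θ r).edgeLength (Fin.last n) ^ 2 := by
  rw [← area_path _ (Fin.last n),
    (isRegularArc_path_arcPolygon n θ r).area_mul_sin_sq hθ hn hn0, norm_path_sub]

theorem IsRegularOffEdge.perimeter_le (hp : IsRegularOffEdge θ p i) (hθ : 0 < θ)
    (hn : n * θ < Real.pi) (hcot : 0 < Real.cot θ) (harea : |shoelace p| = |shoelace q|)
    (hedge : p.edgeLength i = q.edgeLength j) : p.perimeter ≤ q.perimeter := by
  have hq := mul_four_mul_abs_shoelace_add_le hθ hn hcot.le q j
  rw [← harea, ← hedge, hp.mul_four_mul_abs_shoelace_add_eq hθ hn hcot.le] at hq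
  have hnonneg : 0 ≤ q.perimeter - p.edgeLength i :=
    hedge ▸ dist_nonneg.trans (edgeLength_le_perimeter_sub q j)
  exact (sub_le_sub_iff_right _).1 (le_of_sq_le_sq (le_of_mul_le_mul_left hq hcot) hnonneg)

theorem IsRegularOffEdge.of_perimeter_le (hp : IsRegularOffEdge θ p i) (hθ : 0 < θ)
    (hn : n * θ < Real.pi) (hcot : 0 < Real.cot θ) (hn0 : n ≠ 0)
    (harea : |shoelace p| = |shoelace q|) (hedge : p.edgeLength i = q.edgeLength j)
    (hle : q.perimeter ≤ p.perimeter) : IsRegularOffEdge θ q j := by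
  have hperim : p.perimeter = q.perimeter :=
    (hp.perimeter_le hθ hn hcot harea hedge).antisymm hle
  apply isRegularOffEdge_of_mul_four_mul_abs_shoelace_add_eq hθ hn hcot hn0
  rw [← harea, ← hedge, ← hperim, hp.mul_four_mul_abs_shoelace_add_eq hθ hn hcot.le]

end Minimizer

end Plane

section Pentagon

open Plane

variable {p : Polygon Plane 5} {i : Fin 5} {θ : ℝ}

lemma isUnitPentagon_iff : IsUnitPentagon p ↔ p.IsSimple ∧ |shoelace p| = 1 :=
  and_congr_right fun hp => by
    rw [area_eq_ofReal_abs_shoelace hp (by norm_num), ENNReal.ofReal_eq_one]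

lemma four_mul_lt_pi (hθ : θ ∈ Set.Ioo 0 (Real.pi / 4)) : (4 : ℕ) * θ < Real.pi := by
  push_cast
  linarith [hθ.2]

lemma cot_pos (hθ : θ ∈ Set.Ioo 0 (Real.pi / 4)) : 0 < Real.cot θ := by
  rw [Real.cot_eq_cos_div_sin]
  exact div_pos (Real.cos_pos_of_mem_Ioo ⟨by linarith [hθ.1, hθ.2], by linarith [hθ.1, hθ.2]⟩)
    (Real.sin_pos_of_pos_of_lt_pi hθ.1 (by linarith [hθ.1, hθ.2]))

theorem exists_isUnitPentagon_isRegularOffEdge {e : ℝ} (he : 0 < e) :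
    ∃ θ ∈ Set.Ioo 0 (Real.pi / 4), ∃ p : Polygon Plane 5, IsUnitPentagon p ∧
      ∃ i, p.edgeLength i = e ∧ IsRegularOffEdge θ p i := by
  obtain ⟨θ, hθ, hsolve⟩ := PlanarPath.exists_angle_of_chord he
  have hn := four_mul_lt_pi hθ
  have hsin : 0 < Real.sin (4 * θ) := by
    simpa using PlanarPath.sin_natCast_mul_pos hθ.1 hn four_pos le_rfl
  have hr : 0 < e / (2 * Real.sin (4 * θ)) := by positivity
  have hedge : (arcPolygon 4 θ (e / (2 * Real.sin (4 * θ)))).edgeLength (Fin.last 4) = e := by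
    rw [edgeLength_arcPolygon_last, Nat.cast_ofNat, abs_of_pos hsin, abs_of_pos hr,
      mul_div_cancel₀ _ (by positivity)]
  have hshoelace : shoelace (arcPolygon 4 θ (e / (2 * Real.sin (4 * θ)))) = 1 := by
    have h := shoelace_arcPolygon_mul_sin_sq (r := e / (2 * Real.sin (4 * θ))) hθ.1 hn four_pos
    rw [hedge, Nat.cast_ofNat, mul_comm _ (e ^ 2), hsolve] at h
    exact mul_left_cancel₀ (by positivity) (h.trans (mul_one _).symm)
  exact ⟨θ, hθ, _, isUnitPentagon_iff.2 ⟨isSimple_arcPolygon hθ.1 hn hr.ne' (by norm_num),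
    by rw [hshoelace, abs_one]⟩, _, hedge, Or.inl (isRegularArc_path_arcPolygon 4 θ _)⟩

lemma IsUnitPentagon.isPerimeterMinimizer_of_isRegularOffEdge (hp : IsUnitPentagon p)
    (hθ : θ ∈ Set.Ioo 0 (Real.pi / 4)) (h : IsRegularOffEdge θ p i) :
    IsPerimeterMinimizer (p.edgeLength i) p :=
  ⟨⟨hp, i, rfl⟩, fun _ hq ⟨_, hj⟩ => h.perimeter_le hθ.1 (four_mul_lt_pi hθ) (cot_pos hθ)
    ((isUnitPentagon_iff.1 hp).2.trans (isUnitPentagon_iff.1 hq).2.symm) hj.symm⟩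

theorem exists_isPerimeterMinimizer_and_isRegularOffEdge {e : ℝ} (he : 0 < e) :
    ∃ θ ∈ Set.Ioo 0 (Real.pi / 4), (∃ p, IsPerimeterMinimizer e p) ∧
      ∀ p i, IsPerimeterMinimizer e p → p.edgeLength i = e → IsRegularOffEdge θ p i := by
  obtain ⟨θ, hθ, q, hq, j, rfl, hreg⟩ := exists_isUnitPentagon_isRegularOffEdge he
  refine ⟨θ, hθ, ⟨q, hq.isPerimeterMinimizer_of_isRegularOffEdge hθ hreg⟩, fun p i hp hi => ?_⟩
  exact hreg.of_perimeter_le hθ.1 (four_mul_lt_pi hθ) (cot_pos hθ) four_ne_zero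
    ((isUnitPentagon_iff.1 hq).2.trans (isUnitPentagon_iff.1 hp.1.1).2.symm) hi.symm
    (hp.2 q hq ⟨j, rfl⟩)

end Pentagon

/-! ### Numerical bounds -/

section Numerics

open Plane

variable {p : Polygon Plane 5} {P t : ℝ}

lemma four_mul_cot_four_mul_arctan (ht : t ∈ Set.Ioo 0 1) :
    4 * t * Real.cot (4 * Real.arctan t) = (1 - 6 * t ^ 2 + t ^ 4) / (1 - t ^ 2) := by
  have ht0 : t ≠ 0 := ht.1.ne'
  have h1 : 1 - t ^ 2 ≠ 0 := by nlinarith [ht.1, ht.2]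
  have htan : Real.tan (4 * Real.arctan t) =
      2 * (2 * t / (1 - t ^ 2)) / (1 - (2 * t / (1 - t ^ 2)) ^ 2) := by
    rw [show 4 * Real.arctan t = 2 * (2 * Real.arctan t) by ring, Real.tan_two_mul,
      Real.tan_two_mul, Real.tan_arctan]
  rw [← Real.tan_inv_eq_cot, htan, inv_div]
  field_simp
  ring

lemma cairo_perimeter_lt : 2 * √(2 + √3) < 3.8637035 := by
  have h3 : √3 < 1.7320509 := by
    rw [Real.sqrt_lt' (by norm_num)]; norm_num
  have hsqrt : √(2 + √3) < 1.93185175 := by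
    rw [Real.sqrt_lt' (by norm_num)]; linarith
  linarith

lemma IsUnitPentagon.edgeLength_pos (hp : IsUnitPentagon p) (i : Fin 5) : 0 < p.edgeLength i :=
  dist_pos.2 (vertex_ne_of_isSimple hp.1 (by norm_num) i)

lemma IsUnitPentagon.quadratic_le (hp : IsUnitPentagon p) (hP : p.perimeter ≤ P) (i : Fin 5)
    (ht : t ∈ Set.Ioo 0 1) :
    16 * t + (1 - 6 * t ^ 2 + t ^ 4) / (1 - t ^ 2) * p.edgeLength i ^ 2 ≤
      (P - p.edgeLength i) ^ 2 := by
  have hθ : Real.arctan t ∈ Set.Ioo 0 (Real.pi / 4) :=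
    ⟨Real.arctan_pos.2 ht.1, Real.arctan_one ▸ Real.arctan_strictMono ht.2⟩
  have hcot : t * Real.cot (Real.arctan t) = 1 := by
    rw [← Real.tan_inv_eq_cot, Real.tan_arctan, mul_inv_cancel₀ ht.1.ne']
  have hbound := mul_four_mul_abs_shoelace_add_le hθ.1 (four_mul_lt_pi hθ) (cot_pos hθ).le p i
  rw [(isUnitPentagon_iff.1 hp).2, Nat.cast_ofNat] at hbound
  calc 16 * t + (1 - 6 * t ^ 2 + t ^ 4) / (1 - t ^ 2) * p.edgeLength i ^ 2
    _ = t * (4 * (4 * 1 + Real.cot (4 * Real.arctan t) * p.edgeLength i ^ 2)) := by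
        rw [← four_mul_cot_four_mul_arctan ht]; ring
    _ ≤ t * (Real.cot (Real.arctan t) * (p.perimeter - p.edgeLength i) ^ 2) :=
        mul_le_mul_of_nonneg_left hbound ht.1.le
    _ = (p.perimeter - p.edgeLength i) ^ 2 := by rw [← mul_assoc, hcot, one_mul]
    _ ≤ (P - p.edgeLength i) ^ 2 := by
        have := (hp.edgeLength_pos i).le.trans (edgeLength_le_perimeter_sub p i)
        gcongr

lemma convexOn_sq_sub_sub {C : ℝ} (hC : C ≤ 1) (P : ℝ) :
    ConvexOn ℝ Set.univ fun x => (P - x) ^ 2 - C * x ^ 2 := by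
  have h := ((even_two.convexOn_pow (𝕜 := ℝ)).smul (sub_nonneg.2 hC)).add
    (((LinearMap.mulLeft ℝ (-2 * P)).convexOn convex_univ).add_const (P ^ 2))
  refine h.congr fun x _ => ?_
  simp only [Pi.add_apply, smul_eq_mul, LinearMap.mulLeft_apply]
  ring

lemma IsUnitPentagon.edgeLength_notMem_Icc (hp : IsUnitPentagon p) (hP : p.perimeter ≤ P)
    (i : Fin 5) (ht : t ∈ Set.Ioo 0 1) {a b : ℝ}
    (ha : (P - a) ^ 2 - (1 - 6 * t ^ 2 + t ^ 4) / (1 - t ^ 2) * a ^ 2 < 16 * t)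
    (hb : (P - b) ^ 2 - (1 - 6 * t ^ 2 + t ^ 4) / (1 - t ^ 2) * b ^ 2 < 16 * t) :
    p.edgeLength i ∉ Set.Icc a b := by
  intro hi
  have ht1 : 0 < 1 - t ^ 2 := by nlinarith [ht.1, ht.2]
  have hC : (1 - 6 * t ^ 2 + t ^ 4) / (1 - t ^ 2) ≤ 1 := by
    rw [div_le_one ht1]
    nlinarith [sq_nonneg t]
  have hmax := (convexOn_sq_sub_sub hC P).le_max_of_mem_Icc trivial trivial hi
  linarith [hmax.trans_lt (max_lt ha hb), hp.quadratic_le hP i ht]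

theorem IsEfficientPentagon.edgeLength_mem (hp : IsEfficientPentagon p) (i : Fin 5) :
    0.3928 < p.edgeLength i ∧ p.edgeLength i < 1.092 := by
  have hP := hp.2.trans cairo_perimeter_lt.le
  have hpos := hp.1.edgeLength_pos i
  have hle := edgeLength_le_perimeter_sub p i
  have h₁ := hp.1.edgeLength_notMem_Icc hP i (t := 0.935) (a := 0) (b := 0.25)
    (by norm_num) (by norm_num) (by norm_num)
  have h₂ := hp.1.edgeLength_notMem_Icc hP i (t := 0.8604) (a := 0.25) (b := 0.3928)
    (by norm_num) (by norm_num) (by norm_num)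
  have h₃ := hp.1.edgeLength_notMem_Icc hP i (t := 0.6074) (a := 1.092) (b := 1.7)
    (by norm_num) (by norm_num) (by norm_num)
  have h₄ := hp.1.edgeLength_notMem_Icc hP i (t := 0.41) (a := 1.7) (b := 1.94)
    (by norm_num) (by norm_num) (by norm_num)
  grind

theorem IsUnitPentagon.edgeLength_mem (hp : IsUnitPentagon p) (hP : p.perimeter ≤ 3.86)
    (i : Fin 5) : 0.4073 < p.edgeLength i ∧ p.edgeLength i < 1.081 := by
  have hpos := hp.edgeLength_pos i
  have hle := edgeLength_le_perimeter_sub p i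
  have h₁ := hp.edgeLength_notMem_Icc hP i (t := 0.935) (a := 0) (b := 0.27)
    (by norm_num) (by norm_num) (by norm_num)
  have h₂ := hp.edgeLength_notMem_Icc hP i (t := 0.8551) (a := 0.27) (b := 0.4073)
    (by norm_num) (by norm_num) (by norm_num)
  have h₃ := hp.edgeLength_notMem_Icc hP i (t := 0.6113) (a := 1.081) (b := 1.7)
    (by norm_num) (by norm_num) (by norm_num)
  have h₄ := hp.edgeLength_notMem_Icc hP i (t := 0.41) (a := 1.7) (b := 1.94)
    (by norm_num) (by norm_num) (by norm_num)
  grind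

end Numerics

end

theorem proposition2p11 :
    (∀ e : ℝ, 0 < e →
      (∃ p : Polygon Plane 5, IsPerimeterMinimizer e p) ∧
      (∀ (p : Polygon Plane 5) (i : Fin 5), IsUnitPentagon p → p.edgeLength i = e →
        (IsPerimeterMinimizer e p ↔
          EuclideanGeometry.Cospherical (Set.range p.vertices) ∧
            ∀ j k : Fin 5, j ≠ i → k ≠ i → p.edgeLength j = p.edgeLength k)) ∧
      (∀ (p q : Polygon Plane 5) (i j : Fin 5),
        IsPerimeterMinimizer e p → p.edgeLength i = e →
        IsPerimeterMinimizer e q → q.edgeLength j = e →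
          Congruent (fun k : Fin 5 => p (i + k)) (fun k : Fin 5 => q (j + k)))) ∧
    (∀ p : Polygon Plane 5, IsEfficientPentagon p →
      ∀ i : Fin 5, 0.3928 < p.edgeLength i ∧ p.edgeLength i < 1.092) ∧
    (∀ p : Polygon Plane 5, IsUnitPentagon p → p.perimeter ≤ 3.86 →
      ∀ i : Fin 5, 0.4073 < p.edgeLength i ∧ p.edgeLength i < 1.081) := by
  refine ⟨fun e he => ?_, fun p hp i => hp.edgeLength_mem i,
    fun p hp hP i => hp.edgeLength_mem hP i⟩
  obtain ⟨θ, hθ, hex, hregular⟩ := exists_isPerimeterMinimizer_and_isRegularOffEdge he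
  refine ⟨hex, fun p i hp hi => ⟨fun h => ?_, fun ⟨hcosph, hequi⟩ => ?_⟩,
    fun p q i j hp hi hq hj => ?_⟩
  · have hreg := hregular p i h hi
    exact ⟨hreg.cospherical, hreg.edgeLength_eq⟩
  · obtain ⟨φ, hφ, hreg⟩ := Plane.exists_isRegularOffEdge hp.1 hcosph hequi
    exact hi ▸ hp.isPerimeterMinimizer_of_isRegularOffEdge hφ hreg
  · exact (hregular p i hp hi).congruent (hregular q j hq hj) hθ.1 (four_mul_lt_pi hθ) four_pos
      (hi.trans hj.symm)
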